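/- Let $r,t$ be fixed integers with $0\le t\le r-2$. An instance of $r$-Set Packing with $t$-Overlap consists of a finite universe $\mathcal U$, a collection $\mathcal S$ of distinct subsets of $\mathcal U$, each with at most $r$ elements, and a non-negative integer $k$, the parameter. The question is whether $\mathcal S$ contains a $(k,r,t)$-set packing, that is, at least $k$ distinct sets of which any two have at most $t$ elements in common. Theorem. $r$-Set Packing with $t$-Overlap possesses a problem kernel with $O(r^r k^{r-t-1})$ elements from the given universe, where the constant in $O(\cdot)$ does not depend on $r$, $t$ and $k$. That is, there is an absolute constant $C$ such that for all integers $r,t$ with $0\le t\le r-2$ there is an algorithm which, given an instance $(\mathcal U,\mathcal S,k)$, computes in time polynomial in the size of the instance (for fixed $r,t$, with $k$ counted in unary) an instance $(\mathcal U',\mathcal S',k')$ such that 1. $\mathcal S'$ contains a $(k',r,t)$-set packing if and only if $\mathcal S$ contains a $(k,r,t)$-set packing; 2. $|\mathcal U'|\le C\,r^r k^{r-t-1}$ and $k'\le k$, and the size of the encoding of $(\mathcal U',\mathcal S',k')$ is bounded by a polynomial in $k$ that depends only on $r$ and $t$; 3. up to renaming the elements, $\mathcal U'\subseteq\mathcal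 U$ and $\mathcal S'\subseteq\mathcal S$. -/

import Mathlib

/-! ### Machine model: while-programs on binary trees, with a step count -/

/-- The data on which programs operate: finite binary trees with unlabelled nodes. -/
inductive BinTree : Type
  | leaf : BinTree
  | node (l r : BinTree) : BinTree
  deriving DecidableEq

namespace BinTree

/-- The size of a piece of data: its number of nodes, leaves included. -/
def size : BinTree → ℕ
  | leaf => 1
  | node l r => l.size + r.size + 1

/-- Left component of a pair (`leaf` has no components; it is left unchanged). -/
def left : BinTree → BinTree
  | leaf => leaf
  | node l _ => l

/-- Right component of a pair (`leaf` has no components; it is left unchanged). -/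
def right : BinTree → BinTree
  | leaf => leaf
  | node _ r => r

/-- Outcome of comparing the two components of a pair. A `leaf` stands for `false`, any other
tree for `true`. -/
def compare : BinTree → BinTree
  | leaf => leaf
  | node l r => if l = r then node leaf leaf else leaf

/-- A list of pieces of data as one piece of data. -/
def ofList : List BinTree → BinTree
  | [] => leaf
  | a :: l => node a (ofList l)

/-- A natural number in unary. -/
def ofNat : ℕ → BinTree
  | 0 => leaf
  | m + 1 => node leaf (ofNat m)

end BinTree

/-- Programs. Each one transforms a tree into a tree. The control structures are sequential
composition, pairing of two results, branching and (unbounded) while-loops. -/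
inductive TreeProg : Type
  | id : TreeProg
  | leaf : TreeProg
  | left : TreeProg
  | right : TreeProg
  | compare : TreeProg
  | pair (p q : TreeProg) : TreeProg
  | seq (p q : TreeProg) : TreeProg
  | cond (b p q : TreeProg) : TreeProg
  | loop (b p : TreeProg) : TreeProg

/-- `p.Run x y m`: on input `x` the program `p` halts with output `y` after `m` steps.
A basic operation on `x` costs `x.size + 1` steps, i.e. time linear in the data that it has to
read or copy (so time `m` is time polynomial in `m` on a Turing machine). A control structure costs
the sum of what is executed, plus one. -/
inductive TreeProg.Run : TreeProg → BinTree → BinTree → ℕ → Prop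
  | id (x : BinTree) : Run .id x x (x.size + 1)
  | leaf (x : BinTree) : Run .leaf x .leaf (x.size + 1)
  | left (x : BinTree) : Run .left x x.left (x.size + 1)
  | right (x : BinTree) : Run .right x x.right (x.size + 1)
  | compare (x : BinTree) : Run .compare x x.compare (x.size + 1)
  | pair {p q : TreeProg} {x y z : BinTree} {m n : ℕ} :
      Run p x y m → Run q x z n → Run (.pair p q) x (.node y z) (m + n + 1)
  | seq {p q : TreeProg} {x y z : BinTree} {m n : ℕ} :
      Run p x y m → Run q y z n → Run (.seq p q) x z (m + n + 1)
  | cond_true {b p q : TreeProg} {x v y : BinTree} {m n : ℕ} :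
      Run b x v m → v ≠ .leaf → Run p x y n → Run (.cond b p q) x y (m + n + 1)
  | cond_false {b p q : TreeProg} {x y : BinTree} {m n : ℕ} :
      Run b x .leaf m → Run q x y n → Run (.cond b p q) x y (m + n + 1)
  | loop_exit {b p : TreeProg} {x : BinTree} {m : ℕ} :
      Run b x .leaf m → Run (.loop b p) x x (m + 1)
  | loop_step {b p : TreeProg} {x v y z : BinTree} {m n l : ℕ} :
      Run b x v m → v ≠ .leaf → Run p x y n → Run (.loop b p) y z l →
      Run (.loop b p) x z (m + n + l + 1)

/-! ### The problem -/

/-- An instance of `r`-Set Packing with `t`-Overlap (the instances do not depend on `t`):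
a universe with `n` elements, a collection of distinct subsets of it, each with at most `r`
elements, and the parameter `k`. -/
structure PackingInstance (r : ℕ) where
  n : ℕ
  sets : Finset (Finset (Fin n))
  card_le : ∀ A ∈ sets, A.card ≤ r
  k : ℕ

namespace PackingInstance

variable {r : ℕ}

/-- `K` is a `(k, r, t)`-set packing of the instance: at least `k` sets of the collection, any two
of which have at most `t` elements in common. -/
def IsPacking (I : PackingInstance r) (t : ℕ) (K : Finset (Finset (Fin I.n))) : Prop :=
  K ⊆ I.sets ∧ I.k ≤ K.card ∧ ∀ A ∈ K, ∀ B ∈ K, A ≠ B → (A ∩ B).card ≤ t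

/-- `I` is a yes-instance of `r`-Set Packing with `t`-Overlap. -/
def IsYes (I : PackingInstance r) (t : ℕ) : Prop :=
  ∃ K : Finset (Finset (Fin I.n)), I.IsPacking t K

/-- Up to the names of the elements, the universe of `J` is a subset of the universe of `I` and the
collection of `J` is a subcollection of that of `I`. -/
def IsSubinstance (J I : PackingInstance r) : Prop :=
  ∃ φ : Fin J.n ↪ Fin I.n, ∀ A ∈ J.sets, A.map φ ∈ I.sets

/-- The tree `d` encodes `I`: it lists the size of the universe and the parameter, both in unary,
and the sets of the collection. Every set is the list of its elements, without repetition and in any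
order; the sets come without repetition and in any order. -/
def EncodedBy (I : PackingInstance r) (d : BinTree) : Prop :=
  ∃ L : List (List (Fin I.n)),
    (∀ l ∈ L, l.Nodup) ∧ (L.map List.toFinset).Nodup ∧ (L.map List.toFinset).toFinset = I.sets ∧
    d = .node (.ofNat I.n) (.node (.ofNat I.k)
      (.ofList (L.map fun l => .ofList (l.map fun x => .ofNat x.val))))

end PackingInstance

/-- `p` is a kernelization algorithm for `r`-Set Packing with `t`-Overlap, parameterized by `k`,
that leaves at most `bound k` elements, all of them from the given universe: from every instance
it computes, in polynomial time, an equivalent instance over at most `bound k` elements of the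
universe, whose parameter is at most `k` and whose total size is bounded in terms of `k`
(by a polynomial). -/
def IsPackingKernelization (r t : ℕ) (p : TreeProg) (bound : ℕ → ℕ) : Prop :=
  ∃ time size : Polynomial ℕ, ∀ (I : PackingInstance r) (d : BinTree), I.EncodedBy d →
    ∃ (J : PackingInstance r) (e : BinTree) (m : ℕ),
      p.Run d e m ∧ m ≤ time.eval d.size ∧ J.EncodedBy e ∧
      (J.IsYes t ↔ I.IsYes t) ∧
      J.n ≤ bound I.k ∧ J.k ≤ I.k ∧ e.size ≤ size.eval I.k ∧
      J.IsSubinstance I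

/-! ### Polynomial-time functions on encodable types -/

/-! Let k ≥ 1. Sets are chosen greedily into a collection R such that every P with t+1 ≤ |P| ≤ r-1
lies in at most (rk)^(r-1-|P|) sets of R; call P full when this number is attained. A set with a
full subset of r-1 elements (the threshold is then 1) goes into a second collection Q. Any other set
with a full subset P is discarded. This is harmless: if it occurs in a packing of k sets, the other
members meet P in at most t elements each. A set of R that contains P and meets one of them in more
than t elements therefore contains P and a further element of that member. There are fewer than k ·
r · (rk)^(r-2-|P|) = (rk)^(r-1-|P|) such sets, so some set of R containing P can replace the
discarded one (`exists_packing_of_discard`).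

R also stops growing at r^(r-1) k^(r-t-1) sets. At that size it contains a packing by itself: each
set of R would otherwise share t+1 elements with one of fewer than k members of a maximal packing,
which leaves fewer than k · r^(t+1) · (rk)^(r-t-2) sets (`exists_packing_of_card`).

Let V be the union of R, with at most r|R| elements. A set of Q not inside V consists of r-1
elements of some member of R and a single outer element. These sets are the edges of a bipartite
graph between outer elements and inner parts. A matching with a König-type certificate H makes it
enough to keep the matched outer elements: a packing member with inner part in H is replaced by the
matched set with the same inner part (`exists_packing_of_matching`). The inner parts are
(r-1)-subsets of members of R, at most r per member, so at most 2r|R| ≤ 2 r^r k^(r-t-1) elements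
remain.

The matching comes from an auction with integer prices; H is read off from a gap in the prices
(`auction_spec`). Polynomial running time follows from closure properties of `PolyTime`, above all
closure under folds whose state stays small. -/

theorem Polynomial.eval_nat_mono (p : Polynomial ℕ) {a b : ℕ} (h : a ≤ b) :
    p.eval a ≤ p.eval b := by
  rw [Polynomial.eval_eq_sum_range, Polynomial.eval_eq_sum_range]
  gcongr

/-- The cost model charges for all data read or copied, so a time bound is also a bound on the size
of the output. Compositions need this. -/
theorem TreeProg.Run.size_le {p : TreeProg} {x y : BinTree} {m : ℕ} (h : p.Run x y m) :
    x.size ≤ m ∧ y.size ≤ m := by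
  induction h with
  | left x => cases x <;> (simp [BinTree.left, BinTree.size]; try omega)
  | right x => cases x <;> (simp [BinTree.right, BinTree.size]; try omega)
  | compare x =>
    cases x
    · simp [BinTree.compare, BinTree.size]
    · rename_i l r
      have h1 : 1 ≤ l.size := by cases l <;> simp [BinTree.size]
      have h2 : 1 ≤ r.size := by cases r <;> simp [BinTree.size]
      simp only [BinTree.compare, BinTree.size]
      split_ifs <;> (simp [BinTree.size]; try omega)
  | id x => simp
  | leaf x => simp [BinTree.size]
  | _ => (try simp only [BinTree.size] at *); omega

/-- Types whose elements are represented by pieces of data. -/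
class TreeEncodable (α : Type) where
  /-- The representation of an element. -/
  enc : α → BinTree
  enc_injective : Function.Injective enc

open TreeEncodable (enc enc_injective)

/-- The size of the representation. -/
def esize {α : Type} [TreeEncodable α] (a : α) : ℕ := (enc a).size

theorem one_le_esize {α : Type} [TreeEncodable α] (a : α) : 1 ≤ esize a := by
  unfold esize; cases enc a <;> simp [BinTree.size]

theorem BinTree.ofNat_injective : Function.Injective BinTree.ofNat := by
  intro a b h
  induction a generalizing b with
  | zero => cases b <;> simp_all [BinTree.ofNat]
  | succ a ih =>
    cases b with
    | zero => simp [BinTree.ofNat] at h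
    | succ b => rw [ih (BinTree.node.inj h).2]

theorem BinTree.ofList_injective : Function.Injective BinTree.ofList := by
  intro a b h
  induction a generalizing b with
  | nil => cases b <;> simp_all [BinTree.ofList]
  | cons x a ih =>
    cases b with
    | nil => simp [BinTree.ofList] at h
    | cons y b => rw [ih (BinTree.node.inj h).2, (BinTree.node.inj h).1]

instance : TreeEncodable ℕ := ⟨BinTree.ofNat, BinTree.ofNat_injective⟩

instance : TreeEncodable Unit := ⟨fun _ => .leaf, fun _ _ _ => rfl⟩

instance : TreeEncodable Bool :=
  ⟨fun b => bif b then .node .leaf .leaf else .leaf, by intro a b; cases a <;> cases b <;> simp⟩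

instance {α β : Type} [TreeEncodable α] [TreeEncodable β] : TreeEncodable (α × β) :=
  ⟨fun x => .node (enc x.1) (enc x.2), by
    rintro ⟨a, b⟩ ⟨c, d⟩ h
    simp only [BinTree.node.injEq] at h
    rw [enc_injective h.1, enc_injective h.2]⟩

instance {α : Type} [TreeEncodable α] : TreeEncodable (List α) :=
  ⟨fun l => .ofList (l.map enc),
    BinTree.ofList_injective.comp (List.map_injective_iff.2 enc_injective)⟩

section

variable {α β γ δ ε σ : Type} [TreeEncodable α] [TreeEncodable β] [TreeEncodable γ]
  [TreeEncodable δ] [TreeEncodable ε] [TreeEncodable σ]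

theorem enc_pair (a : α) (b : β) : enc (a, b) = .node (enc a) (enc b) := rfl

theorem enc_cons (a : α) (l : List α) : enc (a :: l) = .node (enc a) (enc l) := rfl

/-- Unary numbers and lists of units are the same trees. Recursion on a number is thus a fold over a
list. -/
theorem enc_replicate_unit (n : ℕ) : enc (List.replicate n ()) = enc n := by
  induction n with
  | zero => rfl
  | succ n ih =>
    rw [List.replicate_succ, enc_cons, ih]; rfl

@[simp] theorem esize_pair (a : α) (b : β) : esize (a, b) = esize a + esize b + 1 := rfl

@[simp] theorem esize_nil : esize ([] : List α) = 1 := rfl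

@[simp] theorem esize_cons (a : α) (l : List α) : esize (a :: l) = esize a + esize l + 1 := rfl

@[simp] theorem esize_unit (a : Unit) : esize a = 1 := rfl

theorem esize_bool_le (b : Bool) : esize b ≤ 3 := by cases b <;> simp [esize, enc, BinTree.size]

@[simp] theorem esize_nat (n : ℕ) : esize n = 2 * n + 1 := by
  induction n with
  | zero => rfl
  | succ n ih =>
    have : esize (n + 1) = 1 + esize n + 1 := rfl
    omega

theorem esize_append (l l' : List α) : esize (l ++ l') + 1 = esize l + esize l' := by
  induction l with
  | nil => simp; omega
  | cons a l ih => simp; omega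

theorem length_lt_esize (l : List α) : l.length < esize l := by
  induction l with
  | nil => simp
  | cons a l ih => simp; omega

/-- `f` is computed by a program in time polynomial in the size of the representation. -/
def PolyTime (f : α → β) : Prop :=
  ∃ (p : TreeProg) (T : Polynomial ℕ), ∀ x, ∃ m,
    p.Run (enc x) (enc (f x)) m ∧ m ≤ T.eval (esize x)

/-! ### Closure properties of polynomial-time functions. -/

namespace PolyTime

theorem exists_size_bound {f : α → β} (hf : PolyTime f) :
    ∃ T : Polynomial ℕ, ∀ x, esize (f x) ≤ T.eval (esize x) := by
  obtain ⟨p, T, h⟩ := hf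
  refine ⟨T, fun x => ?_⟩
  obtain ⟨m, hm, hle⟩ := h x
  exact hm.size_le.2.trans hle

/-- A program also computes every function with the same effect on representations. -/
theorem of_enc {f : α → β} (hf : PolyTime f) {f' : γ → δ} (g : γ → α)
    (hg : ∀ x, enc (g x) = enc x) (hf' : ∀ x, enc (f (g x)) = enc (f' x)) : PolyTime f' := by
  obtain ⟨p, T, h⟩ := hf
  refine ⟨p, T, fun x => ?_⟩
  obtain ⟨m, hm, hle⟩ := h (g x)
  rw [hg, hf'] at hm
  rw [esize, hg] at hle
  exact ⟨m, hm, hle⟩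

theorem of_basic {f : α → β} (p : TreeProg)
    (h : ∀ x, p.Run (enc x) (enc (f x)) ((enc x).size + 1)) : PolyTime f :=
  ⟨p, Polynomial.X + 1, fun x => ⟨_, h x, by simp [esize]⟩⟩

protected theorem id : PolyTime fun x : α => x := of_basic .id fun _ => .id _

theorem fst : PolyTime fun x : α × β => x.1 := of_basic .left fun _ => .left _

theorem snd : PolyTime fun x : α × β => x.2 := of_basic .right fun _ => .right _

theorem pred : PolyTime fun n : ℕ => n - 1 := of_basic .right fun n => by
  cases n <;> exact .right _

protected theorem comp {g : β → γ} {f : α → β} (hg : PolyTime g) (hf : PolyTime f) :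
    PolyTime fun x => g (f x) := by
  obtain ⟨p, T, h⟩ := hf
  obtain ⟨p', T', h'⟩ := hg
  refine ⟨.seq p p', T + T'.comp T + 1, fun x => ?_⟩
  obtain ⟨m, hm, hle⟩ := h x
  obtain ⟨m', hm', hle'⟩ := h' (f x)
  refine ⟨_, .seq hm hm', ?_⟩
  have := T'.eval_nat_mono (hm.size_le.2.trans hle)
  simp only [Polynomial.eval_add, Polynomial.eval_comp, Polynomial.eval_one]
  exact Nat.add_le_add_right (Nat.add_le_add hle (hle'.trans this)) 1

theorem pair {f : α → β} {g : α → γ} (hf : PolyTime f) (hg : PolyTime g) :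
    PolyTime fun x => (f x, g x) := by
  obtain ⟨p, T, h⟩ := hf
  obtain ⟨p', T', h'⟩ := hg
  refine ⟨.pair p p', T + T' + 1, fun x => ?_⟩
  obtain ⟨m, hm, hle⟩ := h x
  obtain ⟨m', hm', hle'⟩ := h' x
  refine ⟨_, .pair hm hm', ?_⟩
  simp only [Polynomial.eval_add, Polynomial.eval_one]
  omega

theorem const (b : β) : PolyTime fun _ : α => b := by
  suffices h : ∀ t : BinTree, ∃ (p : TreeProg) (T : Polynomial ℕ), ∀ x : BinTree, ∃ m,
      p.Run x t m ∧ m ≤ T.eval x.size by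
    obtain ⟨p, T, h⟩ := h (enc b)
    exact ⟨p, T, fun x => h (enc x)⟩
  intro t
  induction t with
  | leaf => exact ⟨.leaf, Polynomial.X + 1, fun x => ⟨_, .leaf x, by simp⟩⟩
  | node l r hl hr =>
    obtain ⟨p, T, h⟩ := hl
    obtain ⟨p', T', h'⟩ := hr
    refine ⟨.pair p p', T + T' + 1, fun x => ?_⟩
    obtain ⟨m, hm, hle⟩ := h x
    obtain ⟨m', hm', hle'⟩ := h' x
    refine ⟨_, .pair hm hm', ?_⟩
    simp only [Polynomial.eval_add, Polynomial.eval_one]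
    omega

/-- Branching on whether a value is represented by the trivial tree. -/
theorem branch {b : α → γ} {f g h : α → β} (hb : PolyTime b) (hf : PolyTime f) (hg : PolyTime g)
    (ht : ∀ x, enc (b x) ≠ .leaf → h x = f x) (he : ∀ x, enc (b x) = .leaf → h x = g x) :
    PolyTime h := by
  obtain ⟨p, T, hp⟩ := hb
  obtain ⟨p₁, T₁, h₁⟩ := hf
  obtain ⟨p₂, T₂, h₂⟩ := hg
  refine ⟨.cond p p₁ p₂, T + T₁ + T₂ + 1, fun x => ?_⟩
  simp only [Polynomial.eval_add, Polynomial.eval_one]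
  obtain ⟨m, hm, hle⟩ := hp x
  obtain ⟨m₁, hm₁, hle₁⟩ := h₁ x
  obtain ⟨m₂, hm₂, hle₂⟩ := h₂ x
  by_cases hx : enc (b x) = .leaf
  · rw [he x hx]
    exact ⟨_, .cond_false (hx ▸ hm) hm₂, by omega⟩
  · rw [ht x hx]
    exact ⟨_, .cond_true hm hx hm₁, by omega⟩

protected theorem cond {b : α → Bool} {f g : α → β} (hb : PolyTime b) (hf : PolyTime f)
    (hg : PolyTime g) : PolyTime fun x => bif b x then f x else g x :=
  hb.branch hf hg (fun x hx => by cases h : b x <;> simp_all [enc])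
    (fun x hx => by cases h : b x <;> simp_all [enc])

protected theorem ite {b : α → Prop} [DecidablePred b] {f g : α → β}
    (hb : PolyTime fun x => decide (b x)) (hf : PolyTime f) (hg : PolyTime g) :
    PolyTime fun x => if b x then f x else g x := by
  have := hb.cond hf hg
  simpa only [Bool.cond_decide] using this

theorem decide_eq [DecidableEq β] {f g : α → β} (hf : PolyTime f) (hg : PolyTime g) :
    PolyTime fun x => decide (f x = g x) := by
  have : PolyTime fun x : β × β => decide (x.1 = x.2) := of_basic .compare fun x => by
    have h : enc (decide (x.1 = x.2)) = (enc x).compare := by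
      obtain ⟨a, b⟩ := x
      rw [enc_pair, BinTree.compare]
      by_cases hab : a = b
      · simp [hab, enc]
      · simp [hab, enc, enc_injective.ne hab]
    rw [h]
    exact .compare _
  exact this.comp (hf.pair hg)

theorem decide_not {b : α → Prop} [DecidablePred b] (hb : PolyTime fun x => decide (b x)) :
    PolyTime fun x => decide (¬ b x) := by
  have := hb.cond (const false) (const true) (β := Bool)
  convert this using 2 with x
  by_cases h : b x <;> simp [h]

theorem decide_and {b c : α → Prop} [DecidablePred b] [DecidablePred c]
    (hb : PolyTime fun x => decide (b x)) (hc : PolyTime fun x => decide (c x)) :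
    PolyTime fun x => decide (b x ∧ c x) := by
  have := hb.cond hc (const false)
  convert this using 2 with x
  by_cases h : b x <;> simp [h]

theorem decide_or {b c : α → Prop} [DecidablePred b] [DecidablePred c]
    (hb : PolyTime fun x => decide (b x)) (hc : PolyTime fun x => decide (c x)) :
    PolyTime fun x => decide (b x ∨ c x) := by
  have := hb.cond (const true) hc
  convert this using 2 with x
  by_cases h : b x <;> simp [h]

theorem decide_imp {b c : α → Prop} [DecidablePred b] [DecidablePred c]
    (hb : PolyTime fun x => decide (b x)) (hc : PolyTime fun x => decide (c x)) :
    PolyTime fun x => decide (b x → c x) := by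
  have := hb.cond hc (const true)
  convert this using 2 with x
  by_cases h : b x <;> simp [h]

/-- A nonempty list and the pair of its head and tail have the same tree, so pairing already does
the work. The successor of a unary number is treated likewise. -/
theorem cons {f : α → β} {g : α → List β} (hf : PolyTime f) (hg : PolyTime g) :
    PolyTime fun x => f x :: g x :=
  (hf.pair hg).of_enc id (fun _ => rfl) fun _ => rfl

theorem succ {f : α → ℕ} (hf : PolyTime f) : PolyTime fun x => f x + 1 :=
  ((const ()).pair hf).of_enc id (fun _ => rfl) fun _ => rfl

/-- A fold is polynomial-time if its step is and if its results are of polynomial size. -/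
theorem foldl_core {step : ε → σ → α → σ}
    (hs : PolyTime fun x : ε × σ × α => step x.1 x.2.1 x.2.2) (q : Polynomial ℕ)
    (hq : ∀ e s l, esize (List.foldl (step e) s l) ≤ q.eval (esize (e, s, l))) :
    PolyTime fun x : ε × σ × List α => x.2.2.foldl (step x.1) x.2.1 := by
  have hbody : PolyTime fun x : ε × σ × α × List α =>
      (x.1, step x.1 x.2.1 x.2.2.1, x.2.2.2) :=
    fst.pair ((hs.comp (fst.pair ((fst.comp snd).pair (fst.comp (snd.comp snd))))).pair
      (snd.comp (snd.comp snd)))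
  have hguard : PolyTime fun x : ε × σ × List α => x.2.2 := snd.comp snd
  obtain ⟨pb, Tb, hb⟩ := hbody
  obtain ⟨pg, Tg, hg⟩ := hguard
  -- If `M` bounds the size of every intermediate state of the loop, each round costs at most the
  -- polynomials at `M`; one more test of the guard ends the loop.
  have key : ∀ (M : ℕ) (e : ε) (l : List α) (s : σ),
      (∀ l₁ l₂, l = l₁ ++ l₂ → esize (e, l₁.foldl (step e) s, l₂) ≤ M) →
      ∃ m, (TreeProg.loop pg pb).Run (enc (e, s, l))
        (enc (e, l.foldl (step e) s, ([] : List α))) m ∧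
        m ≤ (l.length + 1) * (Tb.eval M + Tg.eval M + 1) := by
    intro M e l
    induction l with
    | nil =>
      intro s hM
      obtain ⟨m, hm, hle⟩ := hg (e, s, [])
      refine ⟨_, .loop_exit hm, ?_⟩
      have := Tg.eval_nat_mono (hM [] [] rfl)
      simp only [List.foldl_nil] at this
      simp only [List.length_nil]
      omega
    | cons a l ih =>
      intro s hM
      obtain ⟨m, hm, hle⟩ := hg (e, s, a :: l)
      obtain ⟨m', hm', hle'⟩ := hb (e, s, a, l)
      obtain ⟨m'', hm'', hle''⟩ := ih (step e s a) fun l₁ l₂ h => hM (a :: l₁) l₂ (by simp [h])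
      refine ⟨_, .loop_step hm (by simp [enc_cons]) hm' hm'', ?_⟩
      have h0 := hM [] (a :: l) rfl
      have h1 := Tg.eval_nat_mono h0
      have h2 := Tb.eval_nat_mono h0
      simp only [List.foldl_nil] at h1 h2
      have h3 : esize (e, s, a, l) = esize (e, s, a :: l) := rfl
      rw [h3] at hle'
      rw [List.length_cons, add_mul _ 1 (_ : ℕ), one_mul]
      omega
  have hloop : PolyTime fun x : ε × σ × List α =>
      (x.1, x.2.2.foldl (step x.1) x.2.1, ([] : List α)) := by
    let B : Polynomial ℕ := Polynomial.X + q + Polynomial.X + 2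
    refine ⟨.loop pg pb, (Polynomial.X + 1) * (Tb.comp B + Tg.comp B + 1), fun x => ?_⟩
    obtain ⟨e, s, l⟩ := x
    obtain ⟨m, hm, hle⟩ := key (B.eval (esize (e, s, l))) e l s (by
      rintro l₁ l₂ rfl
      have h1 := hq e s l₁
      have h2 : esize l₁ ≤ esize (l₁ ++ l₂) := by
        have := esize_append l₁ l₂; have := one_le_esize l₂; omega
      have h3 : esize l₂ ≤ esize (l₁ ++ l₂) := by
        have := esize_append l₁ l₂; have := one_le_esize l₁; omega
      have h4 := q.eval_nat_mono
        (show esize (e, s, l₁) ≤ esize (e, s, l₁ ++ l₂) by simp only [esize_pair]; omega)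
      have h5 : esize e + esize l₂ ≤ esize (e, s, l₁ ++ l₂) := by simp only [esize_pair]; omega
      simp only [B, Polynomial.eval_add, Polynomial.eval_X, Polynomial.eval_ofNat]
      rw [esize_pair, esize_pair]
      omega)
    refine ⟨m, hm, hle.trans ?_⟩
    simp only [Polynomial.eval_mul, Polynomial.eval_add, Polynomial.eval_X, Polynomial.eval_one,
      Polynomial.eval_comp]
    have := length_lt_esize l
    gcongr
    simp only [esize_pair]
    omega
  exact (fst.comp snd).comp hloop

/-- A fold is polynomial-time if its step is and if a step increases the size of the state by an
amount that does not depend on the state. -/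
theorem foldl {step : ε → σ → α → σ} {s : ε → σ} {l : ε → List α} (hl : PolyTime l)
    (h0 : PolyTime s) (hs : PolyTime fun x : ε × σ × α => step x.1 x.2.1 x.2.2)
    (q : Polynomial ℕ)
    (hq : ∀ e s a, esize (step e s a) ≤ esize s + q.eval (esize e + esize a)) :
    PolyTime fun x => (l x).foldl (step x) (s x) := by
  refine (foldl_core (ε := ε) hs (Polynomial.X + Polynomial.X * q) ?_).comp
    (PolyTime.id.pair (h0.pair hl))
  intro e s l
  -- The increments do not depend on the state, so they add up along the list instead of
  -- compounding.
  have : ∀ (N : ℕ) (l : List α), esize e + esize l ≤ N → ∀ s,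
      esize (l.foldl (step e) s) ≤ esize s + l.length * q.eval N := by
    intro N l
    induction l with
    | nil => simp
    | cons a l ih =>
      intro hN s
      rw [esize_cons] at hN
      have h1 := ih (by omega) (step e s a)
      have h2 := hq e s a
      have h3 := q.eval_nat_mono (show esize e + esize a ≤ N by omega)
      rw [List.foldl_cons, List.length_cons, Nat.succ_mul]
      omega
  refine (this (esize (e, s, l)) l (by simp only [esize_pair]; omega) s).trans ?_
  simp only [Polynomial.eval_add, Polynomial.eval_mul, Polynomial.eval_X]
  have := length_lt_esize l
  gcongr <;> (simp only [esize_pair]; omega)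

theorem reverse {l : α → List β} (hl : PolyTime l) : PolyTime fun x => (l x).reverse := by
  have := foldl (step := fun (_ : α) (s : List β) a => a :: s) hl (const [])
    ((snd.comp snd).cons (fst.comp snd)) (Polynomial.X + 1) (by
      intro e s a; simp; omega)
  simpa only [List.foldl_flip_cons_eq_append', List.append_nil] using this

theorem foldr {step : ε → α → σ → σ} {s : ε → σ} {l : ε → List α} (hl : PolyTime l)
    (h0 : PolyTime s) (hs : PolyTime fun x : ε × α × σ => step x.1 x.2.1 x.2.2)
    (q : Polynomial ℕ)
    (hq : ∀ e a s, esize (step e a s) ≤ esize s + q.eval (esize e + esize a)) :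
    PolyTime fun x => (l x).foldr (step x) (s x) := by
  have := foldl (step := fun e s a => step e a s) hl.reverse h0
    (hs.comp (fst.pair ((snd.comp snd).pair (fst.comp snd)))) q fun e s a => hq e a s
  simpa using this

theorem map {l : ε → List α} {f : ε → α → β} (hl : PolyTime l)
    (hf : PolyTime fun x : ε × α => f x.1 x.2) : PolyTime fun x => (l x).map (f x) := by
  obtain ⟨T, hT⟩ := hf.exists_size_bound
  have := foldr (step := fun e a (s : List β) => f e a :: s) hl (const [])
    ((hf.comp (fst.pair (fst.comp snd))).cons (snd.comp snd)) (T.comp (Polynomial.X + 1) + 1) (by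
      intro e a s
      have := hT (e, a)
      simp at this ⊢
      omega)
  simpa only [List.map_eq_foldr] using this

theorem filter {l : ε → List α} {b : ε → α → Prop} [∀ x, DecidablePred (b x)] (hl : PolyTime l)
    (hb : PolyTime fun x : ε × α => decide (b x.1 x.2)) :
    PolyTime fun x => (l x).filter (fun a => decide (b x a)) := by
  have := foldr (step := fun e a (s : List α) => if b e a then a :: s else s) hl (const [])
    (PolyTime.ite (b := fun x : ε × α × List α => b x.1 x.2.1)
      (hb.comp (fst.pair (fst.comp snd))) ((fst.comp snd).cons (snd.comp snd)) (snd.comp snd))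
    (Polynomial.X + 1) (by
      intro e a s
      split_ifs <;> simp; omega)
  convert this using 2 with x
  induction l x with
  | nil => rfl
  | cons a l ih => simp [List.filter_cons, ih]

theorem append {l l' : ε → List α} (hl : PolyTime l) (hl' : PolyTime l') :
    PolyTime fun x => l x ++ l' x := by
  have := foldr (step := fun (_ : ε) a (s : List α) => a :: s) hl hl'
    ((fst.comp snd).cons (snd.comp snd)) (Polynomial.X + 1) (by intro e a s; simp; omega)
  simpa using this

theorem flatMap {l : ε → List α} {f : ε → α → List β} (hl : PolyTime l)
    (hf : PolyTime fun x : ε × α => f x.1 x.2) : PolyTime fun x => (l x).flatMap (f x) := by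
  obtain ⟨T, hT⟩ := hf.exists_size_bound
  have := foldr (step := fun e a (s : List β) => f e a ++ s) hl (const [])
    ((hf.comp (fst.pair (fst.comp snd))).append (snd.comp snd)) (T.comp (Polynomial.X + 1)) (by
      intro e a s
      have := hT (e, a)
      have := esize_append (f e a) s
      simp at *
      omega)
  convert this using 2 with x
  induction l x with
  | nil => rfl
  | cons a l ih => simp [ih]

theorem flatten {l : ε → List (List α)} (hl : PolyTime l) : PolyTime fun x => (l x).flatten := by
  simpa only [List.flatMap_id'] using hl.flatMap (f := fun _ a => a) snd

theorem length {l : ε → List α} (hl : PolyTime l) : PolyTime fun x => (l x).length := by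
  have := foldr (step := fun (_ : ε) (_ : α) (s : ℕ) => s + 1) hl (const 0)
    (succ (snd.comp snd)) 2 (by intro e a s; simp; omega)
  convert this using 2 with x
  induction l x with
  | nil => rfl
  | cons a l ih => rw [List.length_cons, ih, List.foldr_cons]

theorem decide_forall_mem {l : ε → List α} {b : ε → α → Prop} [∀ x, DecidablePred (b x)]
    (hl : PolyTime l) (hb : PolyTime fun x : ε × α => decide (b x.1 x.2)) :
    PolyTime fun x => decide (∀ a ∈ l x, b x a) := by
  have := foldr (step := fun e a (s : Bool) => decide (b e a ∧ s = true)) hl (const true)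
    (decide_and (b := fun x : ε × α × Bool => b x.1 x.2.1) (c := fun x => x.2.2 = true)
      (hb.comp (fst.pair (fst.comp snd))) ((snd.comp snd).decide_eq (const true))) 3 (by
      intro e a s
      have := esize_bool_le (decide (b e a ∧ s = true))
      simp only [Polynomial.eval_ofNat]
      omega)
  convert this using 2 with x
  induction l x with
  | nil => simp
  | cons a l ih => rw [List.foldr_cons, ← ih]; simp

theorem decide_exists_mem {l : ε → List α} {b : ε → α → Prop} [∀ x, DecidablePred (b x)]
    (hl : PolyTime l) (hb : PolyTime fun x : ε × α => decide (b x.1 x.2)) :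
    PolyTime fun x => decide (∃ a ∈ l x, b x a) := by
  have := (hl.decide_forall_mem (b := fun x a => ¬ b x a) hb.decide_not).decide_not
  simpa using this

theorem decide_mem [DecidableEq α] {l : ε → List α} {f : ε → α} (hf : PolyTime f)
    (hl : PolyTime l) : PolyTime fun x => decide (f x ∈ l x) := by
  have := hl.decide_exists_mem (b := fun x a => f x = a) ((hf.comp fst).decide_eq snd)
  simpa using this

/-- A right fold that overwrites its state ends with the first element. -/
theorem take_one {l : ε → List α} (hl : PolyTime l) : PolyTime fun x => (l x).take 1 := by
  have := foldr (step := fun (_ : ε) (a : α) (_ : List α) => [a]) hl (const [])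
    ((fst.comp snd).cons (const [])) (Polynomial.X + 2) (by intro e a s; simp; omega)
  convert this using 2 with x
  cases l x <;> simp

theorem idxOf [DecidableEq α] {l : ε → List α} {f : ε → α} (hf : PolyTime f)
    (hl : PolyTime l) : PolyTime fun x => (l x).idxOf (f x) := by
  have := foldr (step := fun (x : ε) (a : α) (s : ℕ) => if a = f x then 0 else s + 1) hl (const 0)
    (PolyTime.ite (b := fun x : ε × α × ℕ => x.2.1 = f x.1)
      ((fst.comp snd).decide_eq (hf.comp fst)) (const 0) (succ (snd.comp snd))) 2 (by
        intro e a s; split_ifs <;> simp; omega)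
  convert this using 2 with x
  induction l x with
  | nil => rfl
  | cons a l ih => by_cases h : a = f x <;> simp [h, ih]

theorem replicate_unit {f : ε → ℕ} (hf : PolyTime f) :
    PolyTime fun x => List.replicate (f x) () :=
  hf.of_enc id (fun _ => rfl) fun _ => (enc_replicate_unit _).symm

theorem sub {f g : ε → ℕ} (hf : PolyTime f) (hg : PolyTime g) : PolyTime fun x => f x - g x := by
  have := foldl (step := fun (_ : ε) (s : ℕ) (_ : Unit) => s - 1) hg.replicate_unit hf
    (pred.comp (fst.comp snd)) 0 (by intro e s a; simp)
  convert this using 2 with x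
  induction g x with
  | zero => rfl
  | succ n ih => rw [List.replicate_succ', List.foldl_append, ← ih]; rfl

theorem decide_le {f g : ε → ℕ} (hf : PolyTime f) (hg : PolyTime g) :
    PolyTime fun x => decide (f x ≤ g x) := by
  simpa [Nat.sub_eq_zero_iff_le] using (hf.sub hg).decide_eq (const 0)

theorem decide_lt {f g : ε → ℕ} (hf : PolyTime f) (hg : PolyTime g) :
    PolyTime fun x => decide (f x < g x) :=
  hf.succ.decide_le hg

theorem add {f g : ε → ℕ} (hf : PolyTime f) (hg : PolyTime g) : PolyTime fun x => f x + g x := by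
  have := foldl (step := fun (_ : ε) (s : ℕ) (_ : Unit) => s + 1) hg.replicate_unit hf
    (succ (fst.comp snd)) 2 (by intro e s a; simp; omega)
  convert this using 2 with x
  induction g x with
  | zero => rfl
  | succ n ih => rw [List.replicate_succ', List.foldl_append, ← ih]; rfl

theorem mul {f g : ε → ℕ} (hf : PolyTime f) (hg : PolyTime g) : PolyTime fun x => f x * g x := by
  obtain ⟨T, hT⟩ := hf.exists_size_bound
  have := foldl (step := fun (x : ε) (s : ℕ) (_ : Unit) => s + f x) hg.replicate_unit (const 0)
    ((fst.comp snd).add (hf.comp fst)) T (by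
      intro e s a
      have h1 := hT e
      have h2 := T.eval_nat_mono (Nat.le_add_right (esize e) (esize a))
      simp only [esize_nat] at *
      omega)
  convert this using 2 with x
  induction g x with
  | zero => rfl
  | succ n ih => rw [List.replicate_succ', List.foldl_append, ← ih]; rfl

theorem pow {f : ε → ℕ} (hf : PolyTime f) (n : ℕ) : PolyTime fun x => f x ^ n := by
  induction n with
  | zero => simpa using const 1
  | succ n ih => exact ih.mul hf

/-- The list does not depend on the input, so the disjunction is written out in the program. The
tests for different `i` may have unrelated programs and time bounds. -/
theorem decide_exists_mem_const {ι : Type} (l : List ι) {b : ι → ε → Prop}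
    [∀ i, DecidablePred (b i)] (hb : ∀ i, PolyTime fun x => decide (b i x)) :
    PolyTime fun x => decide (∃ i ∈ l, b i x) := by
  induction l with
  | nil => simpa using const false
  | cons i l ih => simpa only [List.exists_mem_cons_iff] using (hb i).decide_or ih

end PolyTime

end

/-! ### Bipartite matching by an auction -/

section

variable {α β γ : Type} [DecidableEq β] [DecidableEq γ]

/-- The first possible bid of an auction (if any), as a list of length at most one. The edges `A`
of a bipartite graph connect bidders `o A` with goods `p A`. The price of a good is the number
of its occurrences in `log`; `cur` lists the edges of the present matching. A bidder without a good
bids for a cheapest one. -/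
def auctionBid (o : α → β) (p : α → γ) (N : ℕ) (E : List α) (log : List γ) (cur : List α) :
    List α :=
  (E.filter fun A => (∀ B ∈ cur, o B ≠ o A) ∧ log.count (p A) < N ∧
    ∀ B ∈ E, o B = o A → log.count (p A) ≤ log.count (p B)).take 1

/-- One step of an auction: the bidder takes the good over from its present owner. -/
def auctionStep (o : α → β) (p : α → γ) (N : ℕ) (E : List α) (s : List γ × List α) :
    List γ × List α :=
  ((auctionBid o p N E s.1 s.2).map p ++ s.1,
    auctionBid o p N E s.1 s.2 ++
      s.2.filter fun B => ∀ A ∈ auctionBid o p N E s.1 s.2, p B ≠ p A)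

/-- The state of an auction after `T` steps. -/
def auction (o : α → β) (p : α → γ) (N T : ℕ) (E : List α) : List γ × List α :=
  (List.replicate T ()).foldl (fun s _ => auctionStep o p N E s) ([], [])

theorem auction_succ (o : α → β) (p : α → γ) (N T : ℕ) (E : List α) :
    auction o p N (T + 1) E = auctionStep o p N E (auction o p N T E) := by
  rw [auction, List.replicate_succ', List.foldl_append]; rfl

theorem auctionBid_cases (o : α → β) (p : α → γ) (N : ℕ) (E : List α) (log : List γ)
    (cur : List α) :
    (auctionBid o p N E log cur = [] ∧ ∀ A ∈ E, (∀ B ∈ cur, o B ≠ o A) → log.count (p A) < N →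
      ∃ B ∈ E, o B = o A ∧ log.count (p B) < log.count (p A)) ∨
    ∃ A ∈ E, auctionBid o p N E log cur = [A] ∧ (∀ B ∈ cur, o B ≠ o A) ∧ log.count (p A) < N ∧
      ∀ B ∈ E, o B = o A → log.count (p A) ≤ log.count (p B) := by
  unfold auctionBid
  generalize h : E.filter (fun A => decide ((∀ B ∈ cur, o B ≠ o A) ∧ log.count (p A) < N ∧
    ∀ B ∈ E, o B = o A → log.count (p A) ≤ log.count (p B))) = l
  cases l with
  | nil =>
    refine Or.inl ⟨rfl, fun A hA h1 h2 => ?_⟩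
    rw [List.filter_eq_nil_iff] at h
    have := h A hA
    simp only [decide_eq_true_eq] at this
    by_contra! h3
    exact this ⟨h1, h2, h3⟩
  | cons A l =>
    have hA : A ∈ A :: l := List.mem_cons_self
    rw [← h, List.mem_filter] at hA
    exact Or.inr ⟨A, hA.1, by simp, by simpa using hA.2⟩

/-- What holds at any time during an auction. -/
structure AuctionInvariant (o : α → β) (p : α → γ) (N : ℕ) (E : List α) (log : List γ)
    (cur : List α) : Prop where
  cur_subset : cur ⊆ E
  log_subset : log ⊆ E.map p
  nodup_goods : (cur.map p).Nodup
  nodup_bidders : (cur.map o).Nodup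
  owned : ∀ v ∈ log, ∃ c ∈ cur, p c = v
  count_le : ∀ v, log.count v ≤ N
  count_le_count : ∀ c ∈ cur, ∀ B ∈ E, o B = o c → log.count (p c) ≤ log.count (p B) + 1

/-- Only an unmatched bidder bids, which keeps `cur` a matching. A good changes hands but never
becomes free again, so every good with a positive price has an owner. -/
theorem auction_invariant (o : α → β) (p : α → γ) (N T : ℕ) (E : List α) :
    AuctionInvariant o p N E (auction o p N T E).1 (auction o p N T E).2 := by
  induction T with
  | zero => constructor <;> simp [auction]
  | succ T ih =>
    rw [auction_succ]
    generalize auction o p N T E = s at ih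
    obtain ⟨log, cur⟩ := s
    rw [auctionStep]
    rcases auctionBid_cases o p N E log cur with ⟨h, -⟩ | ⟨A, hA, h, h1, h2, h3⟩
    · simpa [h] using ih
    · simp only [h, List.map_cons, List.map_nil, List.cons_append, List.nil_append,
        List.mem_singleton, forall_eq]
      have hsub : List.Sublist (cur.filter fun B => decide (p B ≠ p A)) cur := List.filter_sublist
      constructor
      · exact List.cons_subset.2 ⟨hA, fun _ h => ih.cur_subset (hsub.subset h)⟩
      · exact List.cons_subset.2 ⟨List.mem_map_of_mem hA, ih.log_subset⟩
      · rw [List.map_cons, List.nodup_cons]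
        exact ⟨by simp, ih.nodup_goods.sublist (hsub.map p)⟩
      · rw [List.map_cons, List.nodup_cons]
        refine ⟨?_, ih.nodup_bidders.sublist (hsub.map o)⟩
        rintro h
        obtain ⟨B, hB, hBA⟩ := List.mem_map.1 h
        exact h1 B (hsub.subset hB) hBA
      · intro v hv
        by_cases hvA : v = p A
        · exact ⟨A, by simp, hvA.symm⟩
        · obtain ⟨c, hc, rfl⟩ := ih.owned v (by simpa [hvA] using hv)
          exact ⟨c, by simp [hc, hvA], rfl⟩
      · intro v
        have := ih.count_le v
        rw [List.count_cons]
        split_ifs with hv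
        · rw [beq_iff_eq] at hv
          subst hv
          omega
        · omega
      · intro c hc B hB hBc
        have hmono : log.count (p B) ≤ (p A :: log).count (p B) := List.count_le_count_cons
        -- The new owner chose a cheapest good, whose price then rose by one. For the owners that
        -- remain, the price of their own good is unchanged and other prices can only rise.
        rcases List.mem_cons.1 hc with rfl | hc
        · have := h3 B hB hBc
          rw [List.count_cons_self]
          omega
        · simp only [ne_eq, List.mem_filter, decide_eq_true_eq] at hc
          rw [List.count_cons_of_ne (Ne.symm hc.2)]
          have := ih.count_le_count c hc.1 B hB hBc
          simp only at this
          omega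

/-- Each step either lengthens the log by one or leaves the state unchanged, and in the latter case
there will never be another bid. -/
theorem auction_bid_eq_nil_or (o : α → β) (p : α → γ) (N T : ℕ) (E : List α) :
    auctionBid o p N E (auction o p N T E).1 (auction o p N T E).2 = [] ∨
      (auction o p N T E).1.length = T := by
  induction T with
  | zero => right; rfl
  | succ T ih =>
    rw [auction_succ]
    generalize auction o p N T E = s at ih
    obtain ⟨log, cur⟩ := s
    rcases ih with ih | ih
    · simp only at ih
      have : auctionStep o p N E (log, cur) = (log, cur) := by simp [auctionStep, ih]
      exact .inl (by rw [this]; exact ih)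
    · rcases auctionBid_cases o p N E log cur with ⟨h, -⟩ | ⟨A, hA, h, -⟩
      · have : auctionStep o p N E (log, cur) = (log, cur) := by simp [auctionStep, h]
        exact .inl (by rw [this]; exact h)
      · right
        simp only at ih
        simp [auctionStep, h, ih]

/-- The length of the log is the sum of all prices. There are at most `E.length` goods and no price
exceeds `N`, so the log cannot reach length `T`. -/
theorem auction_bid_eq_nil (o : α → β) (p : α → γ) {N T : ℕ} (E : List α)
    (hT : N * E.length < T) :
    auctionBid o p N E (auction o p N T E).1 (auction o p N T E).2 = [] := by
  refine (auction_bid_eq_nil_or o p N T E).resolve_right fun h => ?_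
  have hI := auction_invariant o p N T E
  have h1 := List.sum_toFinset_count_eq_length (auction o p N T E).1
  have h2 : (auction o p N T E).1.toFinset ⊆ (E.map p).toFinset := fun v hv => by
    rw [List.mem_toFinset] at hv ⊢
    exact hI.log_subset hv
  have h3 := (Finset.card_le_card h2).trans (List.toFinset_card_le _)
  rw [List.length_map] at h3
  have h4 := Finset.sum_le_card_nsmul _ _ N
    (fun v (_ : v ∈ (auction o p N T E).1.toFinset) => hI.count_le v)
  rw [h1, smul_eq_mul] at h4
  have := Nat.mul_le_mul_right N h3
  rw [mul_comm N] at hT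
  omega

/-- A long enough auction ends with a matching and a set `H` of matched goods such that unmatched
bidders and owners of goods in `H` are connected with goods in `H` only. -/
theorem auction_spec (o : α → β) (p : α → γ) {N T : ℕ} (E : List α) (hN : E.length < N)
    (hT : N * E.length < T) :
    (auction o p N T E).2 ⊆ E ∧ ((auction o p N T E).2.map p).Nodup ∧
      ((auction o p N T E).2.map o).Nodup ∧ ∃ H : Set γ,
        (∀ A ∈ E, (∀ B ∈ (auction o p N T E).2, o B ≠ o A) → p A ∈ H) ∧
        (∀ c ∈ (auction o p N T E).2, p c ∈ H → ∀ A ∈ E, o A = o c → p A ∈ H) ∧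
        ∀ v ∈ H, ∃ c ∈ (auction o p N T E).2, p c = v := by
  classical
  have hI := auction_invariant o p N T E
  have hstuck := auction_bid_eq_nil o p E hT
  generalize auction o p N T E = s at hI hstuck
  obtain ⟨log, cur⟩ := s
  simp only at hI hstuck ⊢
  refine ⟨hI.cur_subset, hI.nodup_goods, hI.nodup_bidders, ?_⟩
  -- If the cheapest good of an unmatched bidder cost less than `N`, there would still be a bid.
  have hfull : ∀ A ∈ E, (∀ B ∈ cur, o B ≠ o A) → N ≤ log.count (p A) := by
    intro A hA hfree
    obtain ⟨B, hB, hmin⟩ := (E.toFinset.filter fun B => o B = o A).exists_min_image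
      (fun B => log.count (p B)) ⟨A, by simp [hA]⟩
    simp only [Finset.mem_filter, List.mem_toFinset] at hB hmin
    refine le_trans ?_ (hmin A ⟨hA, rfl⟩)
    by_contra! hlt
    rcases auctionBid_cases o p N E log cur with ⟨-, h⟩ | ⟨A', -, h, -⟩
    · obtain ⟨B', hB', ho, hlt'⟩ := h B hB.1 (by rw [hB.2]; exact hfree) hlt
      exact absurd (hmin B' ⟨hB', ho.trans hB.2⟩) (by omega)
    · simp [h] at hstuck
  -- The goods have at most `E.length < N` different prices, so some `j < N` is not a price. `H`
  -- consists of the goods dearer than `j`.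
  obtain ⟨j, hj, hgap⟩ := Finset.exists_mem_notMem_of_card_lt_card
    (s := (E.map fun A => log.count (p A)).toFinset) (t := Finset.range N) (by
      refine (List.toFinset_card_le _).trans_lt ?_
      simpa using hN)
  simp only [Finset.mem_range, List.mem_toFinset, List.mem_map, not_exists, not_and] at hj hgap
  refine ⟨{v | j < log.count v}, fun A hA hfree => hj.trans_le (hfull A hA hfree), ?_, ?_⟩
  · intro c hc hcH A hA ho
    -- The owner paid more than `j` and overpaid by at most one, so its other goods cost at least
    -- `j`; the gap excludes equality.
    have h1 := hI.count_le_count c hc A hA ho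
    have h2 := hgap A hA
    simp only [Set.mem_ofPred_eq] at hcH ⊢
    omega
  · intro v hv
    exact hI.owned v (List.count_pos_iff.1 (lt_of_le_of_lt (Nat.zero_le j) hv))

end

/-! ### Packings -/

section

open Finset

variable {α : Type} [DecidableEq α]

/-- Any two sets of the collection have at most `t` elements in common. -/
def OverlapLE (t : ℕ) (K : Finset (Finset α)) : Prop :=
  ∀ A ∈ K, ∀ B ∈ K, A ≠ B → #(A ∩ B) ≤ t

/-- The sets of a collection that contain a given set. -/
def supersets (R : Finset (Finset α)) (P : Finset α) : Finset (Finset α) := R.filter (P ⊆ ·)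

theorem mem_supersets {R : Finset (Finset α)} {P A : Finset α} :
    A ∈ supersets R P ↔ A ∈ R ∧ P ⊆ A := mem_filter

/-- Among many sets that contain `P`, one can be added to a packing none of whose members meets
`P` in too many elements. -/
theorem exists_superset_inter_le {r t k i : ℕ} {R K : Finset (Finset α)} {P : Finset α} (hr : 1 ≤ r)
    (hk : 1 ≤ k) (hKr : ∀ B ∈ K, #B ≤ r) (hKk : #K < k) (hKP : ∀ B ∈ K, #(P ∩ B) ≤ t)
    (hbound : ∀ x ∉ P, #(supersets R (insert x P)) ≤ (r * k) ^ i)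
    (hP : (r * k) ^ (i + 1) ≤ #(supersets R P)) :
    ∃ A ∈ supersets R P, ∀ B ∈ K, #(A ∩ B) ≤ t := by
  by_contra! h
  -- Each `B` meets `P` in at most `t` elements, so a set that meets `B` in more of them contains an
  -- element of `B` outside `P`.
  have hsub : supersets R P ⊆
      K.biUnion fun B => (B \ P).biUnion fun x => supersets R (insert x P) := by
    intro A hA
    obtain ⟨B, hB, hAB⟩ := h A hA
    have : ¬ A ∩ B ⊆ P ∩ B := fun hs => absurd (card_le_card hs) (by have := hKP B hB; omega)
    obtain ⟨x, hx, hxP⟩ := not_subset.1 this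
    rw [mem_inter] at hx hxP
    rw [mem_supersets] at hA
    simp only [mem_biUnion, mem_sdiff, mem_supersets]
    exact ⟨B, hB, x, ⟨hx.2, fun h => hxP ⟨h, hx.2⟩⟩, hA.1, insert_subset hx.1 hA.2⟩
  have h1 : #(supersets R P) ≤ #K * (r * (r * k) ^ i) := by
    refine (card_le_card hsub).trans (card_biUnion_le_card_mul _ _ _ fun B hB => ?_)
    refine (card_biUnion_le_card_mul _ _ ((r * k) ^ i) fun x hx => ?_).trans ?_
    · exact hbound x (mem_sdiff.1 hx).2
    · exact Nat.mul_le_mul_right _ ((card_le_card sdiff_subset).trans (hKr B hB))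
  have h2 : 0 < r * (r * k) ^ i := by positivity
  have h3 : #K * (r * (r * k) ^ i) < k * (r * (r * k) ^ i) := Nat.mul_lt_mul_of_pos_right hKk h2
  have h4 : k * (r * (r * k) ^ i) = (r * k) ^ (i + 1) := by ring
  omega

/-- A set may be discarded if it has a subset `P` that is contained in many other sets. -/
theorem exists_packing_of_discard {r t k : ℕ} {S S' R : Finset (Finset α)} (hr : 1 ≤ r)
    (hk : 1 ≤ k) (hS : ∀ A ∈ S, #A ≤ r) (hSS' : S' ⊆ S) (hR : R ⊆ S')
    (hbound : ∀ P, t + 1 ≤ #P → #P ≤ r - 1 → #(supersets R P) ≤ (r * k) ^ (r - 1 - #P))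
    (hdiscard : ∀ A ∈ S \ S', ∃ P ⊆ A, t + 1 ≤ #P ∧ #P + 2 ≤ r ∧
      (r * k) ^ (r - 1 - #P) ≤ #(supersets R P))
    {K : Finset (Finset α)} (hKS : K ⊆ S) (hK : OverlapLE t K) (hKk : #K = k) :
    ∃ K' ⊆ S', OverlapLE t K' ∧ #K' = k := by
  induction h : #(K \ S') generalizing K with
  | zero => exact ⟨K, sdiff_eq_empty_iff_subset.1 (card_eq_zero.1 h), hK, hKk⟩
  | succ n ih =>
    obtain ⟨A, hA⟩ : (K \ S').Nonempty := card_pos.1 (by omega)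
    obtain ⟨hAK, hAS'⟩ := mem_sdiff.1 hA
    obtain ⟨P, hPA, hPt, hPr, hP⟩ := hdiscard A (mem_sdiff.2 ⟨hKS hAK, hAS'⟩)
    -- `P` inherits small overlaps from `A`. The replacement `A'` below contains `P`, and `P` has
    -- more than `t` elements, so `A'` is not already in the packing.
    have hKP : ∀ B ∈ K.erase A, #(P ∩ B) ≤ t := fun B hB =>
      (card_le_card (inter_subset_inter_right hPA)).trans
        (hK A hAK B (mem_of_mem_erase hB) (ne_of_mem_erase hB).symm)
    have hcard : #(K.erase A) < k := by rw [card_erase_of_mem hAK]; omega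
    obtain ⟨A', hA', hA'K⟩ := exists_superset_inter_le (R := R) (i := r - 2 - #P) hr hk
      (fun B hB => hS B (hKS (mem_of_mem_erase hB))) hcard hKP
      -- Here `#P + 2 ≤ r` is needed: the bound is applied to sets with one element more than `P`.
      (fun x hx => by
        have hc := card_insert_of_notMem hx
        have := hbound (insert x P) (by omega) (by omega)
        rwa [hc, show r - 1 - (#P + 1) = r - 2 - #P by omega] at this)
      (by rwa [show r - 2 - #P + 1 = r - 1 - #P by omega])
    rw [mem_supersets] at hA'
    have hA'not : A' ∉ K.erase A := fun hmem => by
      have := hKP A' hmem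
      rw [inter_eq_left.2 hA'.2] at this
      omega
    have hA'S : A' ∈ S' := hR hA'.1
    refine ih (K := insert A' (K.erase A)) ?_ ?_ ?_ ?_
    · exact insert_subset (hSS' hA'S) ((erase_subset _ _).trans hKS)
    · intro B hB C hC hBC
      rcases mem_insert.1 hB with rfl | hB' <;> rcases mem_insert.1 hC with rfl | hC'
      · exact absurd rfl hBC
      · exact hA'K C hC'
      · rw [inter_comm]; exact hA'K B hB'
      · exact hK B (mem_of_mem_erase hB') C (mem_of_mem_erase hC') hBC
    · rw [card_insert_of_notMem hA'not, card_erase_of_mem hAK]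
      omega
    · have : insert A' (K.erase A) \ S' = (K \ S').erase A := by
        rw [insert_sdiff_of_mem _ hA'S, erase_sdiff_comm]
      rw [this, card_erase_of_mem hA, h]
      rfl

/-- A large collection with few sets around every `t + 1` elements contains a packing. -/
theorem exists_packing_of_card {r t k : ℕ} {R : Finset (Finset α)} (htr : t + 2 ≤ r) (hk : 1 ≤ k)
    (hR : ∀ A ∈ R, #A ≤ r)
    (hbound : ∀ P, #P = t + 1 → #(supersets R P) ≤ (r * k) ^ (r - 1 - (t + 1)))
    (hcard : r ^ (r - 1) * k ^ (r - t - 1) ≤ #R) : ∃ K ⊆ R, OverlapLE t K ∧ #K = k := by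
  classical
  -- A maximum packing: every other set of `R` shares some `t + 1` elements with one of its members.
  obtain ⟨K, hK, hmax⟩ := (R.powerset.filter (OverlapLE t)).exists_max_image card
    ⟨∅, by simp [OverlapLE]⟩
  rw [mem_filter, mem_powerset] at hK
  obtain ⟨hKR, hKt⟩ := hK
  by_cases hkK : k ≤ #K
  · obtain ⟨K', hK'K, hK'⟩ := exists_subset_card_eq hkK
    exact ⟨K', hK'K.trans hKR, fun A hA B hB => hKt A (hK'K hA) B (hK'K hB), hK'⟩
  exfalso
  obtain ⟨d, rfl⟩ : ∃ d, r = t + 2 + d := ⟨r - (t + 2), by omega⟩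
  set r := t + 2 + d with hr
  rw [show r - 1 - (t + 1) = d by omega] at hbound
  rw [show r - 1 = t + 1 + d by omega, show r - t - 1 = d + 1 by omega] at hcard
  have hsub : R ⊆ K.biUnion fun B =>
      insert B ((B.powersetCard (t + 1)).biUnion fun P => supersets R P) := by
    intro A hA
    rw [mem_biUnion]
    by_cases hAK : A ∈ K
    · exact ⟨A, hAK, mem_insert_self _ _⟩
    by_contra! h
    have hins : OverlapLE t (insert A K) := by
      have key : ∀ B ∈ K, #(B ∩ A) ≤ t := by
        intro B hB
        by_contra! hlt
        obtain ⟨P, hP, hPc⟩ := exists_subset_card_eq (show t + 1 ≤ #(B ∩ A) from hlt)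
        refine h B hB (mem_insert_of_mem (mem_biUnion.2 ⟨P, ?_, ?_⟩))
        · exact mem_powersetCard.2 ⟨hP.trans inter_subset_left, hPc⟩
        · exact mem_supersets.2 ⟨hA, hP.trans inter_subset_right⟩
      intro B hB C hC hBC
      rcases mem_insert.1 hB with rfl | hB' <;> rcases mem_insert.1 hC with rfl | hC'
      · exact absurd rfl hBC
      · rw [inter_comm]; exact key C hC'
      · exact key B hB'
      · exact hKt B hB' C hC' hBC
    have := hmax (insert A K) (by
      rw [mem_filter, mem_powerset]; exact ⟨insert_subset hA hKR, hins⟩)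
    rw [card_insert_of_notMem hAK] at this
    omega
  have h1 : #R ≤ #K * (r ^ (t + 1) * (r * k) ^ d) := by
    refine (card_le_card hsub).trans (card_biUnion_le_card_mul _ _ _ fun B hB => ?_)
    -- A member with at most `t` elements has no subset of size `t + 1` and accounts for itself
    -- only. A larger member is already among the supersets of its own subsets.
    by_cases hBt : #B ≤ t
    · rw [powersetCard_eq_empty.2 (by omega), biUnion_empty]
      have : 0 < r ^ (t + 1) * (r * k) ^ d := by positivity
      rwa [insert_empty_eq, card_singleton]
    · obtain ⟨P, hP, hPc⟩ := exists_subset_card_eq (show t + 1 ≤ #B by omega)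
      rw [insert_eq_of_mem (mem_biUnion.2 ⟨P, mem_powersetCard.2 ⟨hP, hPc⟩,
        mem_supersets.2 ⟨hKR hB, hP⟩⟩)]
      refine (card_biUnion_le_card_mul _ _ ((r * k) ^ d) fun P hP => ?_).trans ?_
      · exact hbound P (mem_powersetCard.1 hP).2
      · refine Nat.mul_le_mul_right _ ?_
        rw [card_powersetCard]
        exact (Nat.choose_le_pow _ _).trans (Nat.pow_le_pow_left (hR B (hKR hB)) _)
  have h2 : 0 < r ^ (t + 1) * (r * k) ^ d := by positivity
  have h3 : #K * (r ^ (t + 1) * (r * k) ^ d) < k * (r ^ (t + 1) * (r * k) ^ d) :=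
    Nat.mul_lt_mul_of_pos_right (by omega) h2
  have h4 : ∀ s, k * (s ^ (t + 1) * (s * k) ^ d) = s ^ (t + 1 + d) * k ^ (d + 1) := by
    intro s; ring
  have h5 := h4 r
  omega

/-- Exchanging the elements outside a set `V` of elements. The sets in `E` have exactly one such
element, and `cur` matches the goods `A ∩ V` in `H`. -/
theorem exists_packing_of_matching {r t k : ℕ} (htr : t + 2 ≤ r) {V : Finset α}
    {K : Finset (Finset α)} {cur : Set (Finset α)} {H : Set (Finset α)} {E : Set (Finset α)}
    {S : Set (Finset α)} (hKS : ∀ A ∈ K, A ∈ S) (hE : ∀ A, A ∈ E ↔ A ∈ S ∧ ¬ A ⊆ V)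
    (hER : ∀ A ∈ E, #(A ∩ V) = r - 1 ∧ #(A \ V) = 1) (hcurE : cur ⊆ E)
    (hbid : ∀ c ∈ cur, ∀ c' ∈ cur, c \ V = c' \ V → c = c')
    (hfree : ∀ A ∈ E, (∀ B ∈ cur, B \ V ≠ A \ V) → A ∩ V ∈ H)
    (hclosed : ∀ c ∈ cur, c ∩ V ∈ H → ∀ A ∈ E, A \ V = c \ V → A ∩ V ∈ H)
    (hown : ∀ v ∈ H, ∃ c ∈ cur, c ∩ V = v) (hK : OverlapLE t K) (hKk : #K = k) :
    ∃ K' : Finset (Finset α), (∀ A ∈ K', A ∈ S ∧ ∀ x ∈ A, x ∈ V ∨ ∃ c ∈ cur, x ∈ c) ∧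
      OverlapLE t K' ∧ #K' = k := by
  classical
  choose! c hc hcV using hown
  set bad : Finset α → Prop := fun A => A ∈ E ∧ A ∩ V ∈ H with hbad
  -- Members with inner part in `H` keep that part but get the outer element matched with it.
  set g : Finset α → Finset α := fun A => if bad A then c (A ∩ V) else A with hg
  have hcross : ∀ A B, bad A → B ∈ K → ¬ bad B → c (A ∩ V) ∩ B ⊆ A ∩ B ∧ c (A ∩ V) ≠ B := by
    intro A B hA hB hBb
    -- If `B` contained the new outer element, the closure of `H` would put the inner part of `B`
    -- into `H`, so `B` would be exchanged as well.
    have hout : ∀ x ∈ c (A ∩ V), x ∉ V → x ∉ B := by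
      intro x hx hxV hxB
      have hBE : B ∈ E := (hE B).2 ⟨hKS B hB, fun h => hxV (h hxB)⟩
      refine hBb ⟨hBE, hclosed _ (hc _ hA.2) (by rw [hcV _ hA.2]; exact hA.2) B hBE ?_⟩
      obtain ⟨y, hy⟩ := card_eq_one.1 (hER B hBE).2
      obtain ⟨z, hz⟩ := card_eq_one.1 (hER _ (hcurE (hc _ hA.2))).2
      have h1 : x ∈ B \ V := mem_sdiff.2 ⟨hxB, hxV⟩
      have h2 : x ∈ c (A ∩ V) \ V := mem_sdiff.2 ⟨hx, hxV⟩
      rw [hy, mem_singleton] at h1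
      rw [hz, mem_singleton] at h2
      rw [hy, hz, ← h1, ← h2]
    constructor
    · intro x hx
      rw [mem_inter] at hx ⊢
      refine ⟨?_, hx.2⟩
      have hxV : x ∈ V := by
        by_contra h
        exact hout x hx.1 h hx.2
      have : x ∈ c (A ∩ V) ∩ V := mem_inter.2 ⟨hx.1, hxV⟩
      rw [hcV _ hA.2] at this
      exact (mem_inter.1 this).1
    · intro heq
      obtain ⟨z, hz⟩ := card_eq_one.1 (hER _ (hcurE (hc _ hA.2))).2
      have hzm : z ∈ c (A ∩ V) \ V := by rw [hz]; exact mem_singleton_self z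
      rw [mem_sdiff] at hzm
      exact hout z hzm.1 hzm.2 (heq ▸ hzm.1)
  have hboth : ∀ A B, bad A → bad B → A ∈ K → B ∈ K → A ≠ B →
      c (A ∩ V) ∩ c (B ∩ V) ⊆ A ∩ B ∧ c (A ∩ V) ≠ c (B ∩ V) := by
    intro A B hA hB hAK hBK hAB
    -- Equal replacements would mean equal inner parts, hence an overlap of `r - 1 > t` elements.
    have hne : c (A ∩ V) ≠ c (B ∩ V) := by
      intro h
      have h1 : A ∩ V = B ∩ V := by rw [← hcV _ hA.2, ← hcV _ hB.2, h]
      have h2 : A ∩ V ⊆ A ∩ B := by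
        intro x hx
        have hx' := hx
        rw [h1] at hx'
        exact mem_inter.2 ⟨(mem_inter.1 hx).1, (mem_inter.1 hx').1⟩
      have h3 := card_le_card h2
      have h4 := hK A hAK B hBK hAB
      have h5 := (hER A hA.1).1
      omega
    refine ⟨fun x hx => ?_, hne⟩
    rw [mem_inter] at hx
    -- Distinct matched sets have distinct outer elements, so what they share lies in `V`.
    have hxV : x ∈ V := by
      by_contra h
      refine hne (hbid _ (hc _ hA.2) _ (hc _ hB.2) ?_)
      obtain ⟨y, hy⟩ := card_eq_one.1 (hER _ (hcurE (hc _ hB.2))).2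
      obtain ⟨z, hz⟩ := card_eq_one.1 (hER _ (hcurE (hc _ hA.2))).2
      have h1 := mem_sdiff.2 ⟨hx.1, h⟩
      have h2 := mem_sdiff.2 ⟨hx.2, h⟩
      rw [hz, mem_singleton] at h1
      rw [hy, mem_singleton] at h2
      rw [hz, hy, ← h1, ← h2]
    have h1 : x ∈ c (A ∩ V) ∩ V := mem_inter.2 ⟨hx.1, hxV⟩
    have h2 : x ∈ c (B ∩ V) ∩ V := mem_inter.2 ⟨hx.2, hxV⟩
    rw [hcV _ hA.2] at h1
    rw [hcV _ hB.2] at h2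
    exact mem_inter.2 ⟨(mem_inter.1 h1).1, (mem_inter.1 h2).1⟩
  have hpair : ∀ A ∈ K, ∀ B ∈ K, A ≠ B → g A ∩ g B ⊆ A ∩ B ∧ g A ≠ g B := by
    intro A hA B hB hAB
    by_cases h1 : bad A <;> by_cases h2 : bad B <;> simp only [hg, h1, h2, if_true, if_false]
    · exact hboth A B h1 h2 hA hB hAB
    · exact hcross A B h1 hB h2
    · have := hcross B A h2 hA h1
      rw [inter_comm A, inter_comm A]
      exact ⟨this.1, this.2.symm⟩
    · exact ⟨Subset.rfl, hAB⟩
  refine ⟨K.image g, ?_, ?_, ?_⟩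
  · intro A hA
    obtain ⟨B, hB, rfl⟩ := mem_image.1 hA
    by_cases h1 : bad B
    · simp only [hg, h1, if_true]
      have := hc _ h1.2
      exact ⟨((hE _).1 (hcurE this)).1, fun x hx => Or.inr ⟨_, this, hx⟩⟩
    · simp only [hg, h1, if_false]
      refine ⟨hKS B hB, fun x hx => ?_⟩
      by_cases hxV : x ∈ V
      · exact .inl hxV
      have hBE : B ∈ E := (hE B).2 ⟨hKS B hB, fun h => hxV (h hx)⟩
      by_contra! hno
      -- A member left unchanged has a matched outer element, if any; otherwise its inner part would
      -- be in `H`.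
      refine h1 ⟨hBE, hfree B hBE fun C hC hCB => hno.2 C hC ?_⟩
      have : x ∈ C \ V := by rw [hCB]; exact mem_sdiff.2 ⟨hx, hxV⟩
      exact (mem_sdiff.1 this).1
  · intro A hA B hB hAB
    obtain ⟨A, hAK, rfl⟩ := mem_image.1 hA
    obtain ⟨B, hBK, rfl⟩ := mem_image.1 hB
    have hne : A ≠ B := fun h => hAB (by rw [h])
    exact (card_le_card (hpair A hAK B hBK hne).1).trans (hK A hAK B hBK hne)
  · rw [card_image_of_injOn, hKk]
    intro A hA B hB hAB
    by_contra hne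
    exact (hpair A hA B hB hne).2 hAB

end

/-! ### The kernelization algorithm -/

section

variable {α β γ ε : Type} [TreeEncodable α] [TreeEncodable β] [TreeEncodable γ] [TreeEncodable ε]

theorem esize_le_of_sublist {l l' : List α} (h : l.Sublist l') : esize l ≤ esize l' := by
  induction h with
  | slnil => exact le_rfl
  | cons a _ ih => rw [esize_cons]; omega
  | cons_cons a _ ih => rw [esize_cons, esize_cons]; omega

/-! ### Running time of the auction. -/

namespace PolyTime

theorem count [DecidableEq α] {l : ε → List α} {f : ε → α} (hl : PolyTime l) (hf : PolyTime f) :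
    PolyTime fun x => (l x).count (f x) := by
  have := (hl.filter (b := fun x a => a = f x) (snd.decide_eq (hf.comp fst))).length
  convert this using 2 with x
  rw [List.count_eq_length_filter]
  rfl

variable [DecidableEq β] [DecidableEq γ]

theorem auctionBid {o : ε → α → β} {p : ε → α → γ} {N : ε → ℕ} {E : ε → List α} {log : ε → List γ}
    {cur : ε → List α} (ho : PolyTime fun x : ε × α => o x.1 x.2)
    (hp : PolyTime fun x : ε × α => p x.1 x.2) (hN : PolyTime N) (hE : PolyTime E)
    (hlog : PolyTime log) (hcur : PolyTime cur) :
    PolyTime fun x => auctionBid (o x) (p x) (N x) (E x) (log x) (cur x) := by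
  unfold _root_.auctionBid
  refine (hE.filter (b := fun x A => (∀ B ∈ cur x, o x B ≠ o x A) ∧
    (log x).count (p x A) < N x ∧
      ∀ B ∈ E x, o x B = o x A → (log x).count (p x A) ≤ (log x).count (p x B)) ?_).take_one
  have ho' : PolyTime fun z : (ε × α) × α => o z.1.1 z.2 := ho.comp ((fst.comp fst).pair snd)
  have hp' : PolyTime fun z : (ε × α) × α => p z.1.1 z.2 := hp.comp ((fst.comp fst).pair snd)
  refine decide_and ?_ (decide_and ?_ ?_)
  · exact (hcur.comp fst).decide_forall_mem
      (b := fun (x : ε × α) B => o x.1 B ≠ o x.1 x.2) (ho'.decide_eq (ho.comp fst)).decide_not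
  · exact ((hlog.comp fst).count hp).decide_lt (hN.comp fst)
  · have h1 := ho'.decide_eq (ho.comp fst)
    have h2 := ((hlog.comp (fst.comp fst)).count (hp.comp fst)).decide_le
      ((hlog.comp (fst.comp fst)).count hp')
    exact (hE.comp fst).decide_forall_mem (b := fun (x : ε × α) B =>
      o x.1 B = o x.1 x.2 → (log x.1).count (p x.1 x.2) ≤ (log x.1).count (p x.1 B))
      (h1.decide_imp h2)

theorem auction {o : ε → α → β} {p : ε → α → γ} {N T : ε → ℕ} {E : ε → List α}
    (ho : PolyTime fun x : ε × α => o x.1 x.2) (hp : PolyTime fun x : ε × α => p x.1 x.2)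
    (hN : PolyTime N) (hT : PolyTime T) (hE : PolyTime E) :
    PolyTime fun x => auction (o x) (p x) (N x) (T x) (E x) := by
  unfold _root_.auction
  obtain ⟨TE, hTE⟩ := hE.exists_size_bound
  have hmap : PolyTime fun y : ε × List α => y.2.map (p y.1) :=
    snd.map (f := fun y => p y.1) (hp.comp ((fst.comp fst).pair snd))
  obtain ⟨Tp, hTp⟩ := hmap.exists_size_bound
  refine foldl (step := fun x s (_ : Unit) => auctionStep (o x) (p x) (N x) (E x) s)
    hT.replicate_unit (const _) ?_ (Tp.comp (Polynomial.X + TE + 1) + TE) ?_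
  · have hbid : PolyTime fun x : ε × (List γ × List α) × Unit =>
        _root_.auctionBid (o x.1) (p x.1) (N x.1) (E x.1) x.2.1.1 x.2.1.2 :=
      auctionBid (o := fun x : ε × (List γ × List α) × Unit => o x.1) (p := fun x => p x.1)
        (ho.comp ((fst.comp fst).pair snd)) (hp.comp ((fst.comp fst).pair snd)) (hN.comp fst)
        (hE.comp fst) (fst.comp (fst.comp snd)) (snd.comp (fst.comp snd))
    refine pair ((hbid.map (f := fun x => p x.1) (hp.comp ((fst.comp fst).pair snd))).append
      (fst.comp (fst.comp snd))) (hbid.append ?_)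
    refine (snd.comp (fst.comp snd)).filter (b := fun (x : ε × (List γ × List α) × Unit) B =>
      ∀ A ∈ _root_.auctionBid (o x.1) (p x.1) (N x.1) (E x.1) x.2.1.1 x.2.1.2, p x.1 B ≠ p x.1 A) ?_
    refine (hbid.comp fst).decide_forall_mem
      (b := fun (y : (ε × (List γ × List α) × Unit) × α) A => p y.1.1 y.2 ≠ p y.1.1 A) ?_
    exact ((hp.comp ((fst.comp (fst.comp fst)).pair (snd.comp fst))).decide_eq
      (hp.comp ((fst.comp (fst.comp fst)).pair snd))).decide_not
  · intro x s a
    obtain ⟨log, cur⟩ := s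
    rw [auctionStep]
    -- A bid is a sublist of `E`, so the growth of the state in one step is bounded in terms of the
    -- input alone.
    have h1 : esize (_root_.auctionBid (o x) (p x) (N x) (E x) log cur) ≤ TE.eval (esize x) :=
      (esize_le_of_sublist ((List.take_sublist _ _).trans List.filter_sublist)).trans (hTE x)
    generalize _root_.auctionBid (o x) (p x) (N x) (E x) log cur = c at h1 ⊢
    have h2 := hTp (x, c)
    have h3 := esize_append (c.map (p x)) log
    have h4 := esize_append c (cur.filter fun B => ∀ A ∈ c, p x B ≠ p x A)
    have h5 : esize (cur.filter fun B => ∀ A ∈ c, p x B ≠ p x A) ≤ esize cur :=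
      esize_le_of_sublist List.filter_sublist
    have h6 := TE.eval_nat_mono (Nat.le_add_right (esize x) 1)
    have h7 := Tp.eval_nat_mono (show esize (x, c) ≤ esize x + 1 + TE.eval (esize x + 1) + 1 by
      rw [esize_pair]; omega)
    simp only [esize_pair, esize_unit, Polynomial.eval_add, Polynomial.eval_comp, Polynomial.eval_X,
      Polynomial.eval_one] at *
    omega

end PolyTime

end

/-- The lists of `i` distinct elements of `A`. -/
def tuples : ℕ → List ℕ → List (List ℕ)
  | 0, _ => [[]]
  | i + 1, A => (tuples i A).flatMap fun P => (A.filter fun x => x ∉ P).map fun x => x :: P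

/-- Some `i` elements of `A` are contained in at least `(r k) ^ (r - 1 - i)` sets of `R`. -/
def IsFull (r k : ℕ) (R : List (List ℕ)) (A : List ℕ) (i : ℕ) : Prop :=
  ∃ P ∈ tuples i A, (r * k) ^ (r - 1 - i) ≤ (R.filter fun B => ∀ x ∈ P, x ∈ B).length

instance (r k : ℕ) (R : List (List ℕ)) (A : List ℕ) (i : ℕ) : Decidable (IsFull r k R A i) :=
  inferInstanceAs (Decidable (∃ P ∈ tuples i A, _ ≤ (R.filter fun B => ∀ x ∈ P, x ∈ B).length))

/-- `A` is not needed for packings, in view of the sets in `R`. -/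
def IsBlocked (r t k : ℕ) (R : List (List ℕ)) (A : List ℕ) : Prop :=
  (∃ i ∈ List.range' (t + 1) (r - 2 - t), IsFull r k R A i) ∨
    r ^ (r - 1) * k ^ (r - t - 1) ≤ R.length

instance (r t k : ℕ) (R : List (List ℕ)) (A : List ℕ) : Decidable (IsBlocked r t k R A) :=
  inferInstanceAs (Decidable ((∃ i ∈ List.range' (t + 1) (r - 2 - t), IsFull r k R A i) ∨
    r ^ (r - 1) * k ^ (r - t - 1) ≤ R.length))

/-- The treatment of a set `A`: it goes into the second collection if it has `r - 1` elements in
common with a set of the first one; otherwise it goes into the first one, or is discarded. -/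
def greedyStep (r t k : ℕ) (s : List (List ℕ) × List (List ℕ)) (A : List ℕ) :
    List (List ℕ) × List (List ℕ) :=
  if IsFull r k s.1 A (r - 1) then (s.1, A :: s.2)
  else if IsBlocked r t k s.1 A then s
  else (A :: s.1, s.2)

/-- The two collections of sets chosen from `S`. -/
def greedy (r t k : ℕ) (S : List (List ℕ)) : List (List ℕ) × List (List ℕ) :=
  S.foldl (greedyStep r t k) ([], [])

/-- The list of the elements of the sets in `S`. -/
def elements (S : List (List ℕ)) : List ℕ := S.flatten.foldr List.insert []

/-- The sets of `S`, listed in the order of their elements in `elements S`. -/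
def canonical (S : List (List ℕ)) : List (List ℕ) :=
  S.map fun A => (elements S).filter fun x => x ∈ A

/-- The elements of `A` outside the union of `R`. -/
def outerPart (R : List (List ℕ)) (A : List ℕ) : List ℕ := A.filter fun x => x ∉ R.flatten

/-- The elements of `A` in the union of `R`. -/
def innerPart (R : List (List ℕ)) (A : List ℕ) : List ℕ := A.filter fun x => x ∈ R.flatten

/-- The sets of `Q` with an element outside the union of `R`. -/
def outerSets (R Q : List (List ℕ)) : List (List ℕ) := Q.filter fun A => ∃ x ∈ A, x ∉ R.flatten

/-- The sets of `Q` that match elements outside the union of `R` with sets inside. -/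
def matchedSets (R Q : List (List ℕ)) : List (List ℕ) :=
  (auction (outerPart R) (innerPart R) ((outerSets R Q).length + 1)
    (((outerSets R Q).length + 1) * ((outerSets R Q).length + 1)) (outerSets R Q)).2

/-- The elements of `V` that are kept. -/
def keptElements (V : List ℕ) (R Q : List (List ℕ)) : List ℕ :=
  V.filter fun x => x ∈ R.flatten ∨ x ∈ (matchedSets R Q).flatten

/-- The sets over the elements that are kept. -/
def keptSets (V : List ℕ) (R Q : List (List ℕ)) : List (List ℕ) :=
  (R ++ Q).filter fun A => ∀ x ∈ A, x ∈ keptElements V R Q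

/-- The sets over the elements that are kept, with these elements renamed. -/
def renamedSets (V : List ℕ) (R Q : List (List ℕ)) : List (List ℕ) :=
  (keptSets V R Q).map fun A => A.map fun x => (keptElements V R Q).idxOf x

/-- The kernel, given the elements and the collections of sets chosen by `greedy`. -/
def kernelOfGreedy (V : List ℕ) (k : ℕ) (s : List (List ℕ) × List (List ℕ)) :
    ℕ × ℕ × List (List ℕ) :=
  ((keptElements V s.1 s.2).length, k, renamedSets V s.1 s.2)

/-- The kernelization: sizes of universes, parameters, and collections of sets. -/
def packingKernel (r t : ℕ) (x : ℕ × ℕ × List (List ℕ)) : ℕ × ℕ × List (List ℕ) :=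
  kernelOfGreedy (elements x.2.2) x.2.1 (greedy r t x.2.1 (canonical x.2.2))

/-! ### Running time of the kernelization. -/

namespace PolyTime

variable {ε : Type} [TreeEncodable ε]

/-- Since `i` is fixed, this is a fixed number of nested polynomial-time operations. -/
theorem tuples {A : ε → List ℕ} (hA : PolyTime A) (i : ℕ) : PolyTime fun x => tuples i (A x) := by
  induction i with
  | zero => exact const _
  | succ i ih =>
    refine ih.flatMap (f := fun x P => ((A x).filter fun y => y ∉ P).map fun y => y :: P) ?_
    refine map (f := fun (x : ε × List ℕ) y => y :: x.2) ?_ (snd.cons (snd.comp fst))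
    exact (hA.comp fst).filter (b := fun (x : ε × List ℕ) y => y ∉ x.2)
      (decide_not (snd.decide_mem (snd.comp fst)))

theorem isFull {R : ε → List (List ℕ)} {A : ε → List ℕ} {k : ε → ℕ} (r i : ℕ) (hR : PolyTime R)
    (hA : PolyTime A) (hk : PolyTime k) :
    PolyTime fun x => decide (IsFull r (k x) (R x) (A x) i) := by
  have h1 : PolyTime fun x : ε × List ℕ =>
      (R x.1).filter fun B => decide (∀ y ∈ x.2, y ∈ B) := by
    refine (hR.comp fst).filter (b := fun (x : ε × List ℕ) B => ∀ y ∈ x.2, y ∈ B) ?_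
    exact (snd.comp fst).decide_forall_mem (b := fun (x : (ε × List ℕ) × List ℕ) y => y ∈ x.2)
      (snd.decide_mem (snd.comp fst))
  exact (hA.tuples i).decide_exists_mem (b := fun x P => (r * k x) ^ (r - 1 - i) ≤
    ((R x).filter fun B => ∀ y ∈ P, y ∈ B).length)
    (((((const r).mul hk).pow _).comp fst).decide_le h1.length)

theorem greedy {S : ε → List (List ℕ)} {k : ε → ℕ} (r t : ℕ) (hS : PolyTime S) (hk : PolyTime k) :
    PolyTime fun x => greedy r t (k x) (S x) := by
  refine foldl (step := fun x s A => greedyStep r t (k x) s A) hS (const _) ?_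
    (Polynomial.X + 1) ?_
  · have hR : PolyTime fun x : ε × (List (List ℕ) × List (List ℕ)) × List ℕ => x.2.1.1 :=
      fst.comp (fst.comp snd)
    have hQ : PolyTime fun x : ε × (List (List ℕ) × List (List ℕ)) × List ℕ => x.2.1.2 :=
      snd.comp (fst.comp snd)
    have hA : PolyTime fun x : ε × (List (List ℕ) × List (List ℕ)) × List ℕ => x.2.2 :=
      snd.comp snd
    have hk' : PolyTime fun x : ε × (List (List ℕ) × List (List ℕ)) × List ℕ => k x.1 :=
      hk.comp fst
    refine PolyTime.ite (isFull r (r - 1) hR hA hk') (hR.pair (hA.cons hQ)) ?_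
    refine PolyTime.ite (b := fun x : ε × (List (List ℕ) × List (List ℕ)) × List ℕ =>
      IsBlocked r t (k x.1) x.2.1.1 x.2.2) (decide_or ?_ ?_) (fst.comp snd) ((hA.cons hR).pair hQ)
    · exact decide_exists_mem_const _ fun i => isFull r i hR hA hk'
    · exact ((const _).mul (hk'.pow _)).decide_le hR.length
  · rintro x ⟨R, Q⟩ A
    rw [greedyStep]
    split_ifs <;> simp <;> omega

theorem elements {S : ε → List (List ℕ)} (hS : PolyTime S) : PolyTime fun x => elements (S x) := by
  refine hS.flatten.foldr (step := fun _ a s => List.insert a s) (const []) ?_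
    (Polynomial.X + 1) ?_
  · have h : PolyTime fun x : ε × ℕ × List ℕ => decide (x.2.1 ∈ x.2.2) :=
      (fst.comp snd).decide_mem (snd.comp snd)
    have := h.ite (snd.comp snd) ((fst.comp snd).cons (snd.comp snd))
    simpa [List.insert] using this
  · intro x a s
    by_cases h : a ∈ s <;> simp [h]
    omega

theorem canonical {S : ε → List (List ℕ)} (hS : PolyTime S) :
    PolyTime fun x => canonical (S x) :=
  hS.map (f := fun x (A : List ℕ) => (_root_.elements (S x)).filter fun y => y ∈ A)
    ((hS.elements.comp fst).filter (b := fun (x : ε × List ℕ) y => y ∈ x.2)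
      (snd.decide_mem (snd.comp fst)))

theorem outerPart {R : ε → List (List ℕ)} {A : ε → List ℕ} (hR : PolyTime R) (hA : PolyTime A) :
    PolyTime fun x => outerPart (R x) (A x) :=
  hA.filter (b := fun x (y : ℕ) => y ∉ (R x).flatten) (snd.decide_mem (hR.flatten.comp fst)).decide_not

theorem innerPart {R : ε → List (List ℕ)} {A : ε → List ℕ} (hR : PolyTime R) (hA : PolyTime A) :
    PolyTime fun x => innerPart (R x) (A x) :=
  hA.filter (b := fun x (y : ℕ) => y ∈ (R x).flatten) (snd.decide_mem (hR.flatten.comp fst))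

theorem outerSets {R Q : ε → List (List ℕ)} (hR : PolyTime R) (hQ : PolyTime Q) :
    PolyTime fun x => outerSets (R x) (Q x) :=
  hQ.filter (b := fun x A => ∃ y ∈ A, y ∉ (R x).flatten) <|
    snd.decide_exists_mem (b := fun (x : ε × List ℕ) y => y ∉ (R x.1).flatten)
      (snd.decide_mem (hR.flatten.comp (fst.comp fst))).decide_not

theorem matchedSets {R Q : ε → List (List ℕ)} (hR : PolyTime R) (hQ : PolyTime Q) :
    PolyTime fun x => matchedSets (R x) (Q x) :=
  have hN := (hR.outerSets hQ).length.succ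
  snd.comp (auction (o := fun x => _root_.outerPart (R x)) (p := fun x => _root_.innerPart (R x))
    ((hR.comp fst).outerPart snd) ((hR.comp fst).innerPart snd) hN (hN.mul hN) (hR.outerSets hQ))

theorem keptElements {V : ε → List ℕ} {R Q : ε → List (List ℕ)} (hV : PolyTime V)
    (hR : PolyTime R) (hQ : PolyTime Q) : PolyTime fun x => keptElements (V x) (R x) (Q x) :=
  hV.filter (b := fun x (y : ℕ) => y ∈ (R x).flatten ∨ y ∈ (_root_.matchedSets (R x) (Q x)).flatten)
    ((snd.decide_mem (hR.flatten.comp fst)).decide_or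
      (snd.decide_mem ((hR.matchedSets hQ).flatten.comp fst)))

theorem keptSets {V : ε → List ℕ} {R Q : ε → List (List ℕ)} (hV : PolyTime V)
    (hR : PolyTime R) (hQ : PolyTime Q) : PolyTime fun x => keptSets (V x) (R x) (Q x) :=
  (hR.append hQ).filter (b := fun x A => ∀ y ∈ A, y ∈ _root_.keptElements (V x) (R x) (Q x)) <|
    snd.decide_forall_mem
      (b := fun (x : ε × List ℕ) y => y ∈ _root_.keptElements (V x.1) (R x.1) (Q x.1))
      (snd.decide_mem ((hV.keptElements hR hQ).comp (fst.comp fst)))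

theorem renamedSets {V : ε → List ℕ} {R Q : ε → List (List ℕ)} (hV : PolyTime V)
    (hR : PolyTime R) (hQ : PolyTime Q) : PolyTime fun x => renamedSets (V x) (R x) (Q x) := by
  refine (hV.keptSets hR hQ).map (f := fun x (A : List ℕ) => A.map fun y =>
    (_root_.keptElements (V x) (R x) (Q x)).idxOf y) ?_
  exact snd.map (f := fun (x : ε × List ℕ) y =>
    (_root_.keptElements (V x.1) (R x.1) (Q x.1)).idxOf y)
    (snd.idxOf ((hV.keptElements hR hQ).comp (fst.comp fst)))

theorem packingKernel (r t : ℕ) : PolyTime (packingKernel r t) := by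
  have hS : PolyTime fun x : ℕ × ℕ × List (List ℕ) => x.2.2 := snd.comp snd
  have hk : PolyTime fun x : ℕ × ℕ × List (List ℕ) => x.2.1 := fst.comp snd
  have hout : PolyTime fun y : List ℕ × ℕ × List (List ℕ) × List (List ℕ) =>
      kernelOfGreedy y.1 y.2.1 y.2.2 :=
    have hR : PolyTime fun y : List ℕ × ℕ × List (List ℕ) × List (List ℕ) => y.2.2.1 :=
      fst.comp (snd.comp snd)
    have hQ : PolyTime fun y : List ℕ × ℕ × List (List ℕ) × List (List ℕ) => y.2.2.2 :=
      snd.comp (snd.comp snd)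
    (fst.keptElements hR hQ).length.pair ((fst.comp snd).pair (fst.renamedSets hR hQ))
  exact hout.comp (hS.elements.pair (hk.pair (hS.canonical.greedy r t hk)))

end PolyTime

/-! ### What the greedy choice of sets achieves -/

section

open Finset

/-- The collection of sets that is given by a list of lists. -/
def toCollection {α : Type} [DecidableEq α] (S : List (List α)) : Finset (Finset α) :=
  (S.map List.toFinset).toFinset

theorem mem_toCollection {α : Type} [DecidableEq α] {S : List (List α)} {X : Finset α} :
    X ∈ toCollection S ↔ ∃ A ∈ S, A.toFinset = X := by
  simp [toCollection]

theorem mem_tuples {i : ℕ} {A P : List ℕ} :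
    P ∈ tuples i A ↔ P.length = i ∧ P.Nodup ∧ P ⊆ A := by
  induction i generalizing P with
  | zero =>
    rw [tuples, List.mem_singleton, List.length_eq_zero_iff]
    exact ⟨fun h => by simp [h], fun h => h.1⟩
  | succ i ih =>
    simp only [tuples, List.mem_flatMap, List.mem_map, List.mem_filter, decide_eq_true_eq, ih]
    constructor
    · rintro ⟨P, ⟨rfl, h1, h2⟩, x, ⟨hx, hxP⟩, rfl⟩
      exact ⟨rfl, List.nodup_cons.2 ⟨hxP, h1⟩, List.cons_subset.2 ⟨hx, h2⟩⟩
    · rintro ⟨h1, h2, h3⟩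
      cases P with
      | nil => simp at h1
      | cons x P =>
        rw [List.nodup_cons] at h2
        rw [List.cons_subset] at h3
        exact ⟨P, ⟨by simpa using h1, h2.2, h3.2⟩, x, ⟨h3.1, h2.1⟩, rfl⟩

theorem length_filter_superset {R : List (List ℕ)} (hR : (R.map List.toFinset).Nodup)
    (P : List ℕ) :
    (R.filter fun B => ∀ x ∈ P, x ∈ B).length = #(supersets (toCollection R) P.toFinset) := by
  have h1 : ((R.filter fun B => ∀ x ∈ P, x ∈ B).map List.toFinset).Nodup :=
    hR.sublist (List.filter_sublist.map _)
  rw [← List.length_map (f := List.toFinset), ← List.toFinset_card_of_nodup h1]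
  congr 1
  ext X
  simp only [List.mem_toFinset, List.mem_map, List.mem_filter, decide_eq_true_eq, mem_supersets,
    mem_toCollection]
  constructor
  · rintro ⟨B, ⟨hB, hPB⟩, rfl⟩
    exact ⟨⟨B, hB, rfl⟩, fun x hx => by simpa using hPB x (by simpa using hx)⟩
  · rintro ⟨⟨B, hB, rfl⟩, hPB⟩
    exact ⟨B, ⟨hB, fun x hx => List.mem_toFinset.1 (hPB (List.mem_toFinset.2 hx))⟩, rfl⟩

theorem isFull_iff {r k : ℕ} {R : List (List ℕ)} (hR : (R.map List.toFinset).Nodup) {A : List ℕ}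
    {i : ℕ} : IsFull r k R A i ↔
      ∃ P ⊆ A.toFinset, #P = i ∧ (r * k) ^ (r - 1 - i) ≤ #(supersets (toCollection R) P) := by
  constructor
  · rintro ⟨P, hP, h⟩
    obtain ⟨h1, h2, h3⟩ := mem_tuples.1 hP
    refine ⟨P.toFinset, fun x hx => ?_, ?_, ?_⟩
    · rw [List.mem_toFinset] at hx ⊢
      exact h3 hx
    · rw [List.toFinset_card_of_nodup h2, h1]
    · rwa [← length_filter_superset hR]
  · rintro ⟨P, h1, h2, h3⟩
    refine ⟨P.toList, mem_tuples.2 ⟨by simpa using h2, P.nodup_toList, fun x hx => ?_⟩, ?_⟩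
    · exact List.mem_toFinset.1 (h1 (mem_toList.1 hx))
    · rwa [length_filter_superset hR, toList_toFinset]

theorem toCollection_cons (A : List ℕ) (R : List (List ℕ)) :
    toCollection (A :: R) = insert A.toFinset (toCollection R) := by
  simp [toCollection]

theorem card_supersets_mono {R R' : Finset (Finset ℕ)} (h : R ⊆ R') (P : Finset ℕ) :
    #(supersets R P) ≤ #(supersets R' P) :=
  card_le_card (filter_subset_filter _ h)

/-- The properties of the collections `R` and `Q` of sets chosen from `S`. -/
structure GreedySpec (r t k : ℕ) (S R Q : List (List ℕ)) : Prop where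
  nodup : ((R ++ Q).map List.toFinset).Nodup
  subset : R ++ Q ⊆ S
  card_supersets_le : ∀ P, t + 1 ≤ #P → #P ≤ r - 1 →
    #(supersets (toCollection R) P) ≤ (r * k) ^ (r - 1 - #P)
  length_le : R.length ≤ r ^ (r - 1) * k ^ (r - t - 1)
  discarded : ∀ A ∈ S, A ∉ R ++ Q → r ^ (r - 1) * k ^ (r - t - 1) ≤ R.length ∨
    ∃ P ⊆ A.toFinset, t + 1 ≤ #P ∧ #P + 2 ≤ r ∧
      (r * k) ^ (r - 1 - #P) ≤ #(supersets (toCollection R) P)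
  inter : ∀ A ∈ Q, ∃ B ∈ R, ∃ P ⊆ A.toFinset ∩ B.toFinset, #P = r - 1

/-- Invariants of the greedy choice, by induction along the list. Since `R` only grows, a reason for
discarding a set stays valid. -/
theorem greedySpec {r t k : ℕ} (htr : t + 2 ≤ r) {S : List (List ℕ)}
    (hS : (S.map List.toFinset).Nodup) :
    GreedySpec r t k S (greedy r t k S).1 (greedy r t k S).2 := by
  induction S using List.reverseRecOn with
  | nil => constructor <;> simp [greedy, toCollection, supersets]
  | append_singleton S A ih =>
    have hstep : greedy r t k (S ++ [A]) = greedyStep r t k (greedy r t k S) A := by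
      simp [greedy]
    rw [List.map_append, List.nodup_append'] at hS
    obtain ⟨hS1, -, hS2⟩ := hS
    have ih := ih hS1
    rw [hstep]
    generalize greedy r t k S = s at ih ⊢
    obtain ⟨R, Q⟩ := s
    simp only at ih
    have hAnot : A.toFinset ∉ (R ++ Q).map List.toFinset := by
      intro h
      obtain ⟨B, hB, hBA⟩ := List.mem_map.1 h
      exact hS2 (List.mem_map_of_mem (ih.subset hB)) (by simp [hBA])
    have hRnodup : (R.map List.toFinset).Nodup := by
      have := ih.nodup
      rw [List.map_append] at this
      exact this.of_append_left
    have hsub : R ++ Q ⊆ S ++ [A] := fun B hB => List.mem_append_left _ (ih.subset hB)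
    have hA : A ∈ S ++ [A] := by simp
    rw [greedyStep]
    split_ifs with h1 h2
    · have hperm : List.Perm (R ++ A :: Q) (A :: (R ++ Q)) := List.perm_middle
      refine ⟨?_, fun B hB => ?_, ih.card_supersets_le, ih.length_le, fun B hB hBn => ?_,
        fun B hB => ?_⟩
      · rw [(hperm.map _).nodup_iff, List.map_cons, List.nodup_cons]
        exact ⟨hAnot, ih.nodup⟩
      · rcases List.mem_cons.1 (hperm.mem_iff.1 hB) with rfl | hB
        exacts [hA, hsub hB]
      · rw [hperm.mem_iff, List.mem_cons, not_or] at hBn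
        refine ih.discarded B ?_ hBn.2
        simpa [hBn.1] using hB
      · rcases List.mem_cons.1 hB with rfl | hB
        · obtain ⟨P, hP, hPc, hcount⟩ := (isFull_iff hRnodup).1 h1
          -- For `r - 1` elements the threshold is `(r * k) ^ 0 = 1`, so being full means lying in
          -- some set of `R`.
          rw [Nat.sub_self, pow_zero] at hcount
          obtain ⟨X, hX⟩ := card_pos.1 hcount
          obtain ⟨hX, hPX⟩ := mem_supersets.1 hX
          obtain ⟨C, hC, rfl⟩ := mem_toCollection.1 hX
          exact ⟨C, hC, P, subset_inter hP hPX, hPc⟩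
        · exact ih.inter B hB
    · refine ⟨ih.nodup, hsub, ih.card_supersets_le, ih.length_le, fun B hB hBn => ?_, ih.inter⟩
      by_cases hBS : B ∈ S
      · exact ih.discarded B hBS hBn
      obtain rfl : B = A := by simpa [hBS] using hB
      rcases h2 with ⟨i, hi, hfull⟩ | h2
      · obtain ⟨P, hP, rfl, hcount⟩ := (isFull_iff hRnodup).1 hfull
        rw [List.mem_range'_1] at hi
        exact .inr ⟨P, hP, hi.1, by omega, hcount⟩
      · exact .inl h2
    · rw [IsBlocked, not_or] at h2
      have hmono : toCollection R ⊆ toCollection (A :: R) := by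
        rw [toCollection_cons]; exact subset_insert _ _
      refine ⟨?_, ?_, fun P hP1 hP2 => ?_, ?_, fun B hB hBn => ?_, fun B hB => ?_⟩
      · rw [List.cons_append, List.map_cons, List.nodup_cons]
        exact ⟨hAnot, ih.nodup⟩
      · exact List.cons_subset.2 ⟨hA, hsub⟩
      · change #(supersets (toCollection (A :: R)) P) ≤ _
        by_cases hPA : P ⊆ A.toFinset
        -- No subset of `A` was full before `A` was added, and the count rises by at most one.
        · have hlt : #(supersets (toCollection R) P) < (r * k) ^ (r - 1 - #P) := by
            by_contra! hle
            have hfull : IsFull r k R A #P := (isFull_iff hRnodup).2 ⟨P, hPA, rfl, hle⟩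
            rcases eq_or_lt_of_le hP2 with heq | hlt
            · exact h1 (heq ▸ hfull)
            · exact h2.1 ⟨#P, by rw [List.mem_range'_1]; omega, hfull⟩
          have : supersets (toCollection (A :: R)) P ⊆
              insert A.toFinset (supersets (toCollection R) P) := by
            rw [toCollection_cons, supersets, filter_insert, if_pos hPA]
            exact Subset.rfl
          have := (card_le_card this).trans (card_insert_le _ _)
          omega
        · have : supersets (toCollection (A :: R)) P = supersets (toCollection R) P := by
            rw [toCollection_cons, supersets, filter_insert, if_neg hPA, supersets]
          rw [this]
          exact ih.card_supersets_le P hP1 hP2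
      · rw [List.length_cons]
        omega
      · rw [List.cons_append, List.mem_cons, not_or] at hBn
        rcases ih.discarded B (by simpa [hBn.1] using hB) hBn.2 with h | ⟨P, hP, hP1, hP2, hP3⟩
        · exact .inl (h.trans (by simp))
        · exact .inr ⟨P, hP, hP1, hP2, hP3.trans (card_supersets_mono hmono P)⟩
      · obtain ⟨C, hC, h⟩ := ih.inter B hB
        exact ⟨C, List.mem_cons_of_mem _ hC, h⟩

end

/-! ### What is kept -/

section

open Finset

/-- The collection contains a packing of at least `k` sets. -/
def HasPacking {α : Type} [DecidableEq α] (t k : ℕ) (S : Finset (Finset α)) : Prop :=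
  ∃ K ⊆ S, OverlapLE t K ∧ k ≤ #K

theorem HasPacking.exists_card_eq {α : Type} [DecidableEq α] {t k : ℕ} {S : Finset (Finset α)}
    (h : HasPacking t k S) : ∃ K ⊆ S, OverlapLE t K ∧ #K = k := by
  obtain ⟨K, hKS, hK, hk⟩ := h
  obtain ⟨K', hK'K, hK'⟩ := exists_subset_card_eq hk
  exact ⟨K', hK'K.trans hKS, fun A hA B hB => hK A (hK'K hA) B (hK'K hB), hK'⟩

theorem HasPacking.mono {α : Type} [DecidableEq α] {t k : ℕ} {S S' : Finset (Finset α)}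
    (h : HasPacking t k S) (hS : S ⊆ S') : HasPacking t k S' :=
  let ⟨K, hKS, hK⟩ := h
  ⟨K, hKS.trans hS, hK⟩

theorem hasPacking_map_iff {α β : Type} [DecidableEq α] [DecidableEq β] {t k : ℕ} (f : α ↪ β)
    {S : Finset (Finset α)} :
    HasPacking t k (S.map (mapEmbedding f).toEmbedding) ↔ HasPacking t k S := by
  have key : ∀ K : Finset (Finset α),
      OverlapLE t (K.map (mapEmbedding f).toEmbedding) ↔ OverlapLE t K := by
    intro K
    simp only [OverlapLE, forall_mem_map, RelEmbedding.coe_toEmbedding, mapEmbedding_apply,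
      ← map_inter, card_map, ne_eq, map_inj]
  constructor
  · rintro ⟨K, hK, h1, h2⟩
    obtain ⟨K', hK', rfl⟩ := subset_map_iff.1 hK
    exact ⟨K', hK', (key K').1 h1, by simpa using h2⟩
  · rintro ⟨K, hK, h1, h2⟩
    exact ⟨_, map_subset_map.2 hK, (key K).2 h1, by simpa using h2⟩

theorem mem_elements {S : List (List ℕ)} {x : ℕ} : x ∈ elements S ↔ ∃ A ∈ S, x ∈ A := by
  rw [elements, ← List.mem_flatten]
  induction S.flatten with
  | nil => simp
  | cons a l ih => simp [ih]

theorem nodup_elements (S : List (List ℕ)) : (elements S).Nodup := by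
  rw [elements]
  induction S.flatten with
  | nil => simp
  | cons a l ih => exact ih.insert

theorem toFinset_filter_mem_elements {S : List (List ℕ)} {A : List ℕ} (hA : A ∈ S) :
    ((elements S).filter fun x => x ∈ A).toFinset = A.toFinset := by
  ext x
  simp only [List.mem_toFinset, List.mem_filter, decide_eq_true_eq, mem_elements]
  exact ⟨fun h => h.2, fun h => ⟨⟨A, hA, h⟩, h⟩⟩

theorem map_toFinset_canonical (S : List (List ℕ)) :
    (canonical S).map List.toFinset = S.map List.toFinset := by
  rw [canonical, List.map_map]
  exact List.map_congr_left fun A hA => toFinset_filter_mem_elements hA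

/-- The elements of `A` are listed in the order of `V`. -/
def IsCanonical (V A : List ℕ) : Prop := V.filter (fun x => x ∈ A) = A

theorem isCanonical_of_mem_canonical {S : List (List ℕ)} {A : List ℕ} (hA : A ∈ canonical S) :
    IsCanonical (elements S) A := by
  obtain ⟨B, hB, rfl⟩ := List.mem_map.1 hA
  refine List.filter_congr fun x hx => ?_
  simp [hx]

theorem IsCanonical.filter {V A : List ℕ} (hA : IsCanonical V A) (p : ℕ → Prop)
    [DecidablePred p] : IsCanonical V (A.filter fun x => p x) := by
  rw [IsCanonical]
  conv_rhs => rw [← hA]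
  rw [List.filter_filter]
  exact List.filter_congr fun x _ => by simp [and_comm]

/-- The auction compares bidders and goods as lists. The common order makes this the same as
comparing them as sets. -/
theorem IsCanonical.eq_of_toFinset_eq {V A B : List ℕ} (hA : IsCanonical V A)
    (hB : IsCanonical V B) (h : A.toFinset = B.toFinset) : A = B := by
  rw [← hA, ← hB]
  refine List.filter_congr fun x _ => ?_
  rw [decide_eq_decide, ← List.mem_toFinset, h, List.mem_toFinset]

theorem IsCanonical.nodup {V A : List ℕ} (hA : IsCanonical V A) (hV : V.Nodup) : A.Nodup := by
  rw [← hA]; exact hV.filter _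

theorem IsCanonical.subset {V A : List ℕ} (hA : IsCanonical V A) : A ⊆ V := by
  rw [← hA]; exact List.filter_subset_self V

theorem toFinset_outerPart (R : List (List ℕ)) (A : List ℕ) :
    (outerPart R A).toFinset = A.toFinset \ R.flatten.toFinset := by
  ext x
  simp only [outerPart, List.mem_toFinset, List.mem_filter, decide_eq_true_eq, mem_sdiff]

theorem toFinset_innerPart (R : List (List ℕ)) (A : List ℕ) :
    (innerPart R A).toFinset = A.toFinset ∩ R.flatten.toFinset := by
  ext x
  simp only [innerPart, List.mem_toFinset, List.mem_filter, decide_eq_true_eq, mem_inter]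

theorem mem_outerSets {R Q : List (List ℕ)} {A : List ℕ} :
    A ∈ outerSets R Q ↔ A ∈ Q ∧ ¬ A.toFinset ⊆ R.flatten.toFinset := by
  simp only [outerSets, List.mem_filter, decide_eq_true_eq, not_subset, List.mem_toFinset]

theorem matchedSets_spec (R Q : List (List ℕ)) :
    matchedSets R Q ⊆ outerSets R Q ∧ ((matchedSets R Q).map (innerPart R)).Nodup ∧
      ((matchedSets R Q).map (outerPart R)).Nodup ∧ ∃ H : Set (List ℕ),
        (∀ A ∈ outerSets R Q, (∀ B ∈ matchedSets R Q, outerPart R B ≠ outerPart R A) →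
          innerPart R A ∈ H) ∧
        (∀ c ∈ matchedSets R Q, innerPart R c ∈ H → ∀ A ∈ outerSets R Q,
          outerPart R A = outerPart R c → innerPart R A ∈ H) ∧
        ∀ v ∈ H, ∃ c ∈ matchedSets R Q, innerPart R c = v :=
  auction_spec _ _ _ (Nat.lt_succ_self _) (by
    rw [Nat.mul_lt_mul_left (Nat.succ_pos _)]; exact Nat.lt_succ_self _)

theorem mem_keptElements {V : List ℕ} {R Q : List (List ℕ)} {x : ℕ} :
    x ∈ keptElements V R Q ↔ x ∈ V ∧ (x ∈ R.flatten ∨ ∃ c ∈ matchedSets R Q, x ∈ c) := by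
  simp only [keptElements, List.mem_filter, decide_eq_true_eq]
  rw [List.mem_flatten (L := matchedSets R Q)]

theorem mem_keptSets {V : List ℕ} {R Q : List (List ℕ)} {A : List ℕ} :
    A ∈ keptSets V R Q ↔ A ∈ R ++ Q ∧ ∀ x ∈ A, x ∈ keptElements V R Q := by
  simp only [keptSets, List.mem_filter, decide_eq_true_eq]

/-! ### Size and correctness of the selection. -/

section

variable {r t k : ℕ} {V : List ℕ} {S R Q : List (List ℕ)}

theorem toFinset_subset_flatten {B : List ℕ} (hB : B ∈ R) : B.toFinset ⊆ R.flatten.toFinset :=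
  fun x hx => by
    rw [List.mem_toFinset] at hx ⊢
    exact List.mem_flatten.2 ⟨B, hB, hx⟩

/-- A set of `Q` has `r - 1` elements in common with some `B ∈ R` and at most `r` in all. An element
outside the union of `R` therefore uses up the remaining place. -/
theorem GreedySpec.outerSet (h : GreedySpec r t k S R Q) (hr : 2 ≤ r)
    (hSr : ∀ A ∈ S, #A.toFinset ≤ r) {A : List ℕ} (hA : A ∈ outerSets R Q) :
    ∃ B ∈ R, A.toFinset ∩ R.flatten.toFinset ⊆ B.toFinset ∧
      #(A.toFinset ∩ R.flatten.toFinset) = r - 1 ∧ #(A.toFinset \ R.flatten.toFinset) = 1 := by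
  obtain ⟨hAQ, hAR⟩ := mem_outerSets.1 hA
  obtain ⟨B, hB, P, hP, hPc⟩ := h.inter A hAQ
  rw [subset_inter_iff] at hP
  have h1 : P ⊆ A.toFinset ∩ R.flatten.toFinset :=
    subset_inter hP.1 (hP.2.trans (toFinset_subset_flatten hB))
  have h2 := card_le_card h1
  have h3 : 1 ≤ #(A.toFinset \ R.flatten.toFinset) :=
    card_pos.2 (sdiff_nonempty.2 hAR)
  have h4 := card_inter_add_card_sdiff A.toFinset R.flatten.toFinset
  have h5 := hSr A (h.subset (List.mem_append_right _ hAQ))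
  refine ⟨B, hB, ?_, by omega, by omega⟩
  rw [← eq_of_subset_of_card_le h1 (by omega)]
  exact hP.2

theorem GreedySpec.innerPart_eq (h : GreedySpec r t k S R Q) (hSV : ∀ A ∈ S, IsCanonical V A)
    {A B : List ℕ} (hA : A ∈ outerSets R Q) (hB : B ∈ outerSets R Q)
    (hAB : A.toFinset ∩ R.flatten.toFinset = B.toFinset ∩ R.flatten.toFinset) :
    innerPart R A = innerPart R B :=
  have hcan : ∀ A ∈ outerSets R Q, IsCanonical V A := fun A hA =>
    hSV A (h.subset (List.mem_append_right _ (mem_outerSets.1 hA).1))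
  ((hcan A hA).filter _).eq_of_toFinset_eq ((hcan B hB).filter _) (by
    rw [← toFinset_innerPart, ← toFinset_innerPart] at hAB
    exact hAB)

theorem GreedySpec.outerPart_eq (h : GreedySpec r t k S R Q) (hSV : ∀ A ∈ S, IsCanonical V A)
    {A B : List ℕ} (hA : A ∈ outerSets R Q) (hB : B ∈ outerSets R Q)
    (hAB : A.toFinset \ R.flatten.toFinset = B.toFinset \ R.flatten.toFinset) :
    outerPart R A = outerPart R B :=
  have hcan : ∀ A ∈ outerSets R Q, IsCanonical V A := fun A hA =>
    hSV A (h.subset (List.mem_append_right _ (mem_outerSets.1 hA).1))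
  ((hcan A hA).filter _).eq_of_toFinset_eq ((hcan B hB).filter _) (by
    rw [← toFinset_outerPart, ← toFinset_outerPart] at hAB
    exact hAB)

theorem GreedySpec.length_keptElements_le (h : GreedySpec r t k S R Q) (hr : 2 ≤ r)
    (hSr : ∀ A ∈ S, #A.toFinset ≤ r) (hSV : ∀ A ∈ S, IsCanonical V A) (hV : V.Nodup) :
    (keptElements V R Q).length ≤ 2 * (r * R.length) := by
  obtain ⟨hsub, hgood, -, -⟩ := matchedSets_spec R Q
  have hnodup : (keptElements V R Q).Nodup := hV.filter _
  rw [← List.toFinset_card_of_nodup hnodup]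
  have h1 : (keptElements V R Q).toFinset ⊆ R.flatten.toFinset ∪
      (matchedSets R Q).toFinset.biUnion fun c => c.toFinset \ R.flatten.toFinset := by
    intro x hx
    rw [List.mem_toFinset, mem_keptElements] at hx
    rw [mem_union]
    by_cases hxR : x ∈ R.flatten
    · exact .inl (List.mem_toFinset.2 hxR)
    · obtain ⟨c, hc, hxc⟩ := hx.2.resolve_left hxR
      refine .inr (mem_biUnion.2 ⟨c, List.mem_toFinset.2 hc, ?_⟩)
      rw [mem_sdiff, List.mem_toFinset, List.mem_toFinset]
      exact ⟨hxc, hxR⟩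
  have hRS : ∀ B ∈ R, #B.toFinset ≤ r := fun B hB => hSr B (h.subset (List.mem_append_left _ hB))
  have h2 : #R.flatten.toFinset ≤ #R.toFinset * r := by
    have : R.flatten.toFinset ⊆ R.toFinset.biUnion List.toFinset := fun x hx => by
      rw [List.mem_toFinset, List.mem_flatten] at hx
      obtain ⟨B, hB, hxB⟩ := hx
      exact mem_biUnion.2 ⟨B, List.mem_toFinset.2 hB, List.mem_toFinset.2 hxB⟩
    exact (card_le_card this).trans
      (card_biUnion_le_card_mul _ _ _ fun B hB => hRS B (List.mem_toFinset.1 hB))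
  have h3 : #((matchedSets R Q).toFinset.biUnion fun c => c.toFinset \ R.flatten.toFinset) ≤
      #(matchedSets R Q).toFinset * 1 :=
    card_biUnion_le_card_mul _ _ _ fun c hc => by
      obtain ⟨-, -, -, -, hc⟩ := h.outerSet hr hSr (hsub (List.mem_toFinset.1 hc))
      exact hc.le
  -- Matched sets are determined by their inner parts, which are `(r - 1)`-subsets of members of
  -- `R`; a member has at most `r` of these.
  have h4 : #(matchedSets R Q).toFinset ≤ #R.toFinset * r := by
    refine le_trans ?_ (card_biUnion_le_card_mul R.toFinset
      (fun B => B.toFinset.powersetCard (r - 1)) r fun B hB => ?_)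
    · refine card_le_card_of_injOn (fun c => c.toFinset ∩ R.flatten.toFinset) ?_ ?_
      · intro c hc
        obtain ⟨B, hB, hcB, hcard, -⟩ := h.outerSet hr hSr (hsub (List.mem_toFinset.1 hc))
        exact mem_coe.2 (mem_biUnion.2
          ⟨B, List.mem_toFinset.2 hB, mem_powersetCard.2 ⟨hcB, hcard⟩⟩)
      · intro c hc c' hc' heq
        rw [mem_coe, List.mem_toFinset] at hc hc'
        exact List.inj_on_of_nodup_map hgood hc hc' (h.innerPart_eq hSV (hsub hc) (hsub hc') heq)
    · rw [card_powersetCard]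
      refine (Nat.choose_le_choose _ (hRS B (List.mem_toFinset.1 hB))).trans ?_
      rw [Nat.choose_symm (by omega : 1 ≤ r), Nat.choose_one_right]
  have h5 := (card_le_card h1).trans (card_union_le _ _)
  have h6 : #R.toFinset * r ≤ r * R.length := by
    rw [mul_comm]; exact Nat.mul_le_mul_left _ (List.toFinset_card_le R)
  omega

theorem GreedySpec.hasPacking_iff (h : GreedySpec r t k S R Q) (htr : t + 2 ≤ r)
    (hSr : ∀ A ∈ S, #A.toFinset ≤ r) (hSV : ∀ A ∈ S, IsCanonical V A) :
    HasPacking t k (toCollection (keptSets V R Q)) ↔ HasPacking t k (toCollection S) := by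
  have hRQ : toCollection (R ++ Q) ⊆ toCollection S := fun X hX => by
    obtain ⟨A, hA, rfl⟩ := mem_toCollection.1 hX
    exact mem_toCollection.2 ⟨A, h.subset hA, rfl⟩
  have hR : toCollection R ⊆ toCollection (R ++ Q) := fun X hX => by
    obtain ⟨A, hA, rfl⟩ := mem_toCollection.1 hX
    exact mem_toCollection.2 ⟨A, List.mem_append_left _ hA, rfl⟩
  have hS : ∀ X ∈ toCollection S, #X ≤ r := fun X hX => by
    obtain ⟨A, hA, rfl⟩ := mem_toCollection.1 hX
    exact hSr A hA
  constructor
  · refine fun hp => hp.mono (Subset.trans (fun X hX => ?_) hRQ)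
    obtain ⟨A, hA, rfl⟩ := mem_toCollection.1 hX
    exact mem_toCollection.2 ⟨A, (mem_keptSets.1 hA).1, rfl⟩
  intro hp
  -- The counting arguments need `k ≥ 1`; the empty packing settles `k = 0`.
  rcases Nat.eq_zero_or_pos k with rfl | hk
  · exact ⟨∅, by simp, by simp [OverlapLE], by simp⟩
  obtain ⟨K, hKRQ, hK, hKk⟩ : ∃ K ⊆ toCollection (R ++ Q), OverlapLE t K ∧ #K = k := by
    -- If `R` is large, sets may have been discarded for no other reason, but then `R` itself
    -- contains a packing. Otherwise every discarded set has a full subset and can be exchanged.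
    by_cases hlarge : r ^ (r - 1) * k ^ (r - t - 1) ≤ R.length
    · have hcard : #(toCollection R) = R.length := by
        have hn := h.nodup
        rw [List.map_append] at hn
        rw [toCollection, List.toFinset_card_of_nodup hn.of_append_left, List.length_map]
      obtain ⟨K, hK, hK'⟩ := exists_packing_of_card htr hk
        (fun X hX => hS X (hRQ (hR hX)))
        (fun P hP => by have := h.card_supersets_le P (by omega) (by omega); rwa [hP] at this)
        (hlarge.trans hcard.ge)
      exact ⟨K, hK.trans hR, hK'⟩
    · obtain ⟨K, hKS, hK, hKk⟩ := hp.exists_card_eq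
      refine exists_packing_of_discard (by omega) hk hS hRQ hR h.card_supersets_le ?_ hKS hK hKk
      intro X hX
      rw [mem_sdiff] at hX
      obtain ⟨A, hA, rfl⟩ := mem_toCollection.1 hX.1
      exact (h.discarded A hA fun hA' => hX.2 (mem_toCollection.2 ⟨A, hA', rfl⟩)).resolve_left
        hlarge
  obtain ⟨hsub, hgood, hbid, H, hfree, hclosed, hown⟩ := matchedSets_spec R Q
  obtain ⟨K', hK'S, hK', hK'k⟩ := exists_packing_of_matching (V := R.flatten.toFinset)
    (cur := {X | ∃ c ∈ matchedSets R Q, c.toFinset = X})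
    -- The certificate of the auction, carried over from lists to sets; by `innerPart_eq` the choice
    -- of `A` is immaterial.
    (H := {v | ∃ A ∈ outerSets R Q, innerPart R A ∈ H ∧ A.toFinset ∩ R.flatten.toFinset = v})
    (E := {X | ∃ A ∈ outerSets R Q, A.toFinset = X}) (S := {X | X ∈ toCollection (R ++ Q)})
    htr hKRQ
    (by
      intro X
      constructor
      · rintro ⟨A, hA, rfl⟩
        rw [mem_outerSets] at hA
        exact ⟨mem_toCollection.2 ⟨A, List.mem_append_right _ hA.1, rfl⟩, hA.2⟩
      · rintro ⟨hX, hXV⟩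
        obtain ⟨A, hA, rfl⟩ := mem_toCollection.1 hX
        refine ⟨A, mem_outerSets.2 ⟨?_, hXV⟩, rfl⟩
        exact (List.mem_append.1 hA).resolve_left fun hA => hXV (toFinset_subset_flatten hA))
    (by
      rintro X ⟨A, hA, rfl⟩
      obtain ⟨-, -, -, h1, h2⟩ := h.outerSet (by omega) hSr hA
      exact ⟨h1, h2⟩)
    (by
      rintro X ⟨c, hc, rfl⟩
      exact ⟨c, hsub hc, rfl⟩)
    (by
      rintro _ ⟨c, hc, rfl⟩ _ ⟨c', hc', rfl⟩ heq
      rw [List.inj_on_of_nodup_map hbid hc hc' 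
        (h.outerPart_eq hSV (hsub hc) (hsub hc') heq)])
    (by
      rintro _ ⟨A, hA, rfl⟩ hno
      refine ⟨A, hA, hfree A hA fun B hB hBA => ?_, rfl⟩
      refine hno _ ⟨B, hB, rfl⟩ ?_
      rw [← toFinset_outerPart, hBA, toFinset_outerPart])
    (by
      rintro _ ⟨c, hc, rfl⟩ ⟨A', hA', hA'H, hA'c⟩ _ ⟨A, hA, rfl⟩ heq
      refine ⟨A, hA, hclosed c hc ?_ A hA (h.outerPart_eq hSV hA (hsub hc) heq), rfl⟩
      rw [← h.innerPart_eq hSV hA' (hsub hc) hA'c]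
      exact hA'H)
    (by
      rintro _ ⟨A, hA, hAH, rfl⟩
      obtain ⟨c, hc, hcA⟩ := hown _ hAH
      refine ⟨_, ⟨c, hc, rfl⟩, ?_⟩
      rw [← toFinset_innerPart, hcA, toFinset_innerPart])
    hK hKk
  refine ⟨K', fun X hX => ?_, hK', hK'k.ge⟩
  obtain ⟨hXS, hXV⟩ := hK'S X hX
  obtain ⟨A, hA, rfl⟩ := mem_toCollection.1 hXS
  refine mem_toCollection.2 ⟨A, mem_keptSets.2 ⟨hA, fun x hx => mem_keptElements.2
    ⟨(hSV A (h.subset hA)).subset hx, ?_⟩⟩, rfl⟩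
  rcases hXV x (List.mem_toFinset.2 hx) with hx' | ⟨_, ⟨c, hc, rfl⟩, hx'⟩
  · exact .inl (List.mem_toFinset.1 hx')
  · exact .inr ⟨c, hc, List.mem_toFinset.1 hx'⟩

end

end

/-! ### The kernel as an instance -/

section

open Finset

theorem map_toFinset_map {α β : Type} [DecidableEq α] [DecidableEq β] (f : α ↪ β)
    (L : List (List α)) :
    (L.map (List.map f)).map List.toFinset = (L.map List.toFinset).map (Finset.map f) := by
  rw [List.map_map, List.map_map]
  refine List.map_congr_left fun l _ => ?_
  ext x
  simp

theorem toCollection_map {α β : Type} [DecidableEq α] [DecidableEq β] (f : α ↪ β)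
    (L : List (List α)) :
    toCollection (L.map (List.map f)) = (toCollection L).map (mapEmbedding f).toEmbedding := by
  ext X
  rw [toCollection, map_toFinset_map]
  simp [toCollection]

/-- The algorithm does not limit the number of sets in `Q`. A bound on the universe suffices, as `r`
is fixed. -/
theorem card_le_of_forall_card_le {m r : ℕ} {F : Finset (Finset (Fin m))} (hF : ∀ X ∈ F, #X ≤ r) :
    #F ≤ (r + 1) * (m + 1) ^ r := by
  have hsub : F ⊆ (range (r + 1)).biUnion fun i => powersetCard i univ := fun X hX =>
    mem_biUnion.2 ⟨#X, mem_range.2 (Nat.lt_succ_of_le (hF X hX)),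
      mem_powersetCard.2 ⟨subset_univ _, rfl⟩⟩
  refine (card_le_card hsub).trans ((card_biUnion_le_card_mul _ _ ((m + 1) ^ r) ?_).trans
    (by rw [card_range]))
  intro i hi
  rw [card_powersetCard, card_univ, Fintype.card_fin]
  calc m.choose i ≤ m ^ i := Nat.choose_le_pow _ _
    _ ≤ (m + 1) ^ i := Nat.pow_le_pow_left (Nat.le_succ m) i
    _ ≤ (m + 1) ^ r := Nat.pow_le_pow_right (Nat.succ_pos m) (Nat.le_of_lt_succ (mem_range.1 hi))

theorem esize_list_le {α : Type} [TreeEncodable α] {l : List α} {c : ℕ}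
    (h : ∀ a ∈ l, esize a ≤ c) : esize l ≤ l.length * (c + 1) + 1 := by
  induction l with
  | nil => simp
  | cons a l ih =>
    have h1 := ih fun b hb => h b (List.mem_cons_of_mem _ hb)
    have h2 := h a List.mem_cons_self
    rw [esize_cons, List.length_cons, Nat.succ_mul]
    omega

theorem exists_map_val_eq {m : ℕ} {S : List (List ℕ)} (h : ∀ A ∈ S, ∀ x ∈ A, x < m) :
    ∃ L : List (List (Fin m)), L.map (List.map Fin.val) = S := by
  have : S ∈ Set.range (List.map (List.map (Fin.val (n := m)))) := by
    rw [Set.range_list_map]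
    intro A hA
    rw [Set.range_list_map]
    intro x hx
    exact ⟨⟨x, h A hA x hx⟩, rfl⟩
  exact this

theorem isYes_iff {r t : ℕ} (I : PackingInstance r) : I.IsYes t ↔ HasPacking t I.k I.sets :=
  ⟨fun ⟨K, h1, h2, h3⟩ => ⟨K, h1, h3, h2⟩, fun ⟨K, h1, h2, h3⟩ => ⟨K, h1, h3, h2⟩⟩

theorem encodedBy_iff {r : ℕ} {I : PackingInstance r} {d : BinTree} :
    I.EncodedBy d ↔ ∃ L : List (List (Fin I.n)), (∀ l ∈ L, l.Nodup) ∧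
      (L.map List.toFinset).Nodup ∧ toCollection L = I.sets ∧
      d = enc (I.n, I.k, L.map (List.map Fin.val)) := by
  have : ∀ L : List (List (Fin I.n)), enc (I.n, I.k, L.map (List.map Fin.val)) =
      .node (.ofNat I.n) (.node (.ofNat I.k)
        (.ofList (L.map fun l => .ofList (l.map fun x => .ofNat x.val)))) := by
    intro L
    rw [enc_pair, enc_pair]
    simp only [enc, List.map_map]
    congr 4
    funext l
    simp
    rfl
  simp only [this]
  rfl

theorem exists_kernel_instance {r t : ℕ} (htr : t + 2 ≤ r) (I : PackingInstance r)
    {L : List (List (Fin I.n))} (hL : (L.map List.toFinset).Nodup)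
    (hLI : toCollection L = I.sets) :
    ∃ J : PackingInstance r,
      J.EncodedBy (enc (packingKernel r t (I.n, I.k, L.map (List.map Fin.val)))) ∧
      (J.IsYes t ↔ I.IsYes t) ∧ J.n ≤ 2 * (r ^ r * I.k ^ (r - t - 1)) ∧ J.k = I.k ∧
      J.IsSubinstance I := by
  set S := L.map (List.map Fin.val) with hSdef
  have hSmap : S = L.map (List.map Fin.valEmbedding) := rfl
  have hSI : toCollection (canonical S) = I.sets.map (mapEmbedding Fin.valEmbedding).toEmbedding := by
    rw [← hLI, ← toCollection_map, toCollection, map_toFinset_canonical]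
    rfl
  have hSnodup : ((canonical S).map List.toFinset).Nodup := by
    rw [map_toFinset_canonical, hSmap, map_toFinset_map]
    exact hL.map (map_injective _)
  have hSr : ∀ A ∈ canonical S, #A.toFinset ≤ r := by
    intro A hA
    have : A.toFinset ∈ toCollection (canonical S) := mem_toCollection.2 ⟨A, hA, rfl⟩
    rw [hSI, mem_map] at this
    obtain ⟨X, hX, hXA⟩ := this
    rw [← hXA]
    exact (card_map _).le.trans (I.card_le X hX)
  have hSV : ∀ A ∈ canonical S, IsCanonical (elements S) A := fun A =>
    isCanonical_of_mem_canonical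
  have hspec := greedySpec (k := I.k) htr hSnodup
  have hV := nodup_elements S
  have hVn : ∀ x ∈ elements S, x < I.n := by
    intro x hx
    obtain ⟨A, hA, hxA⟩ := mem_elements.1 hx
    obtain ⟨l, -, rfl⟩ := List.mem_map.1 hA
    obtain ⟨y, -, rfl⟩ := List.mem_map.1 hxA
    exact y.2
  have hker : packingKernel r t (I.n, I.k, S) =
    kernelOfGreedy (elements S) I.k (greedy r t I.k (canonical S)) := rfl
  rw [hker]
  generalize canonical S = S' at *
  generalize elements S = V at *
  generalize greedy r t I.k S' = s at *
  obtain ⟨R, Q⟩ := s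
  simp only at hspec
  have hiff := hspec.hasPacking_iff htr hSr hSV
  have hlen := hspec.length_keptElements_le (by omega) hSr hSV hV
  have hUnodup : (keptElements V R Q).Nodup := hV.filter _
  have hkept : ((keptSets V R Q).map List.toFinset).Nodup :=
    hspec.nodup.sublist (List.filter_sublist.map _)
  have hkeptU : ∀ A ∈ keptSets V R Q, ∀ x ∈ A, x ∈ keptElements V R Q := fun A hA =>
    (mem_keptSets.1 hA).2
  have hkeptS : ∀ A ∈ keptSets V R Q, A ∈ S' := fun A hA => hspec.subset (mem_keptSets.1 hA).1
  have hUn : ∀ x ∈ keptElements V R Q, x < I.n := fun x hx => hVn x (mem_keptElements.1 hx).1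
  rw [kernelOfGreedy]
  simp only [renamedSets]
  generalize keptSets V R Q = T at *
  generalize keptElements V R Q = U at *
  obtain ⟨L', hL'⟩ : ∃ L' : List (List (Fin U.length)),
      L'.map (List.map Fin.val) = T.map fun A => A.map fun x => U.idxOf x := by
    refine exists_map_val_eq fun A hA x hx => ?_
    obtain ⟨B, hB, rfl⟩ := List.mem_map.1 hA
    obtain ⟨y, hy, rfl⟩ := List.mem_map.1 hx
    exact List.idxOf_lt_length_iff.2 (hkeptU B hB y hy)
  -- A new name is a position in the list of kept elements; `φ` restores the old name.
  let φ : Fin U.length ↪ Fin I.n :=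
    ⟨fun i => ⟨U.get i, hUn _ (U.get_mem i)⟩, fun i j hij =>
      hUnodup.injective_get (congrArg Fin.val hij)⟩
  have hT : L'.map (List.map (φ.trans Fin.valEmbedding)) = T := by
    have h1 : L'.map (List.map (φ.trans Fin.valEmbedding)) =
        -- The default value `0` is never used, since all indices are smaller than `U.length`.
        (L'.map (List.map Fin.val)).map (List.map fun i => U.getD i 0) := by
      rw [List.map_map]
      refine List.map_congr_left fun l _ => ?_
      rw [Function.comp_apply, List.map_map]
      refine List.map_congr_left fun i _ => ?_
      simp [φ]
    rw [h1, hL', List.map_map]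
    conv_rhs => rw [← List.map_id T]
    refine List.map_congr_left fun A hA => ?_
    rw [Function.comp_apply, List.map_map]
    conv_rhs => rw [id, ← List.map_id A]
    refine List.map_congr_left fun x hx => ?_
    have := List.idxOf_lt_length_iff.2 (hkeptU A hA x hx)
    simp [this]
  have hcoll := toCollection_map (φ.trans Fin.valEmbedding) L'
  rw [hT] at hcoll
  have hmem : ∀ X ∈ toCollection L', ∃ Y ∈ I.sets, X.map φ = Y := by
    intro X hX
    have h1 : X.map (φ.trans Fin.valEmbedding) ∈ toCollection T := by
      rw [hcoll]; exact mem_map_of_mem _ hX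
    obtain ⟨A, hA, hAX⟩ := mem_toCollection.1 h1
    have h2 : X.map (φ.trans Fin.valEmbedding) ∈ toCollection S' :=
      mem_toCollection.2 ⟨A, hkeptS A hA, hAX⟩
    rw [hSI, mem_map] at h2
    obtain ⟨Y, hY, hYX⟩ := h2
    refine ⟨Y, hY, map_injective Fin.valEmbedding ?_⟩
    rw [map_map]
    exact hYX.symm
  let J : PackingInstance r := ⟨U.length, toCollection L', fun X hX => by
    obtain ⟨Y, hY, hXY⟩ := hmem X hX
    rw [← card_map φ, hXY]
    exact I.card_le Y hY, I.k⟩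
  refine ⟨J, ?_, ?_, ?_, rfl, φ, fun X hX => ?_⟩
  · have hnodup : (L'.map List.toFinset).Nodup := by
      rw [← hT, map_toFinset_map] at hkept
      exact hkept.of_map
    refine encodedBy_iff.2 ⟨L', fun l hl => ?_, hnodup, rfl, by rw [hL']⟩
    have h1 : l.map (φ.trans Fin.valEmbedding) ∈ T := by
      rw [← hT]; exact List.mem_map_of_mem hl
    exact ((hSV _ (hkeptS _ h1)).nodup hV).of_map
  · rw [isYes_iff, isYes_iff, ← hasPacking_map_iff (φ.trans Fin.valEmbedding),
      ← hasPacking_map_iff Fin.valEmbedding (S := I.sets), ← hSI]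
    change HasPacking t I.k ((toCollection L').map _) ↔ _
    rw [← hcoll]
    exact hiff
  · have h1 := Nat.mul_le_mul_left (2 * r) hspec.length_le
    have h2 : 2 * r * (r ^ (r - 1) * I.k ^ (r - t - 1)) = 2 * (r ^ r * I.k ^ (r - t - 1)) := by
      obtain ⟨s, rfl⟩ : ∃ s, r = s + 1 := ⟨r - 1, by omega⟩
      rw [Nat.add_sub_cancel, pow_succ]
      ring
    change U.length ≤ _
    rw [← h2, mul_assoc]
    rw [mul_assoc, mul_assoc] at h1
    exact hlen.trans h1
  · obtain ⟨Y, hY, hXY⟩ := hmem X hX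
    rw [hXY]
    exact hY

/-- Encodings have polynomial size in terms of the universe and the parameter. -/
theorem PackingInstance.EncodedBy.size_le {r : ℕ} {J : PackingInstance r} {e : BinTree}
    (h : J.EncodedBy e) : e.size ≤
      2 * J.n + 2 * J.k + 5 + (r + 1) * (J.n + 1) ^ r * (r * (2 * J.n + 2) + 2) := by
  obtain ⟨L, hL1, hL2, hL3, rfl⟩ := encodedBy_iff.1 h
  have h1 : L.length ≤ (r + 1) * (J.n + 1) ^ r := by
    rw [← List.length_map (f := List.toFinset), ← List.toFinset_card_of_nodup hL2]
    refine card_le_of_forall_card_le fun X hX => J.card_le X ?_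
    rw [← hL3]
    exact hX
  have h2 : esize (L.map (List.map Fin.val)) ≤ L.length * (r * (2 * J.n + 2) + 2) + 1 := by
    rw [← List.length_map (f := List.map Fin.val)]
    refine esize_list_le (c := r * (2 * J.n + 2) + 1) fun A hA => ?_
    obtain ⟨l, hl, rfl⟩ := List.mem_map.1 hA
    have h3 : l.length ≤ r := by
      rw [← List.toFinset_card_of_nodup (hL1 l hl)]
      refine J.card_le _ ?_
      rw [← hL3]
      exact mem_toCollection.2 ⟨l, hl, rfl⟩
    refine (esize_list_le (c := 2 * J.n + 1) fun x hx => ?_).trans ?_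
    · obtain ⟨y, -, rfl⟩ := List.mem_map.1 hx
      rw [esize_nat]
      have := y.2
      omega
    · rw [List.length_map]
      gcongr
  have h4 := Nat.mul_le_mul_right (r * (2 * J.n + 2) + 2) h1
  change esize (J.n, J.k, L.map (List.map Fin.val)) ≤ _
  rw [esize_pair, esize_pair, esize_nat, esize_nat]
  omega

end

theorem mainTheorem1 :
    ∃ C : ℕ, ∀ r t : ℕ, t + 2 ≤ r →
      ∃ p : TreeProg, IsPackingKernelization r t p (fun k => C * (r ^ r * k ^ (r - t - 1))) := by
  refine ⟨2, fun r t htr => ?_⟩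
  obtain ⟨p, T, hp⟩ := PolyTime.packingKernel r t
  -- `M` is the bound on the universe as a polynomial in `k`; substituting it into
  -- `EncodedBy.size_le` gives the bound on the size of the encoding.
  let M : Polynomial ℕ := Polynomial.C (2 * r ^ r) * Polynomial.X ^ (r - t - 1)
  refine ⟨p, T, 2 * M + 2 * Polynomial.X + 5 +
    Polynomial.C (r + 1) * (M + 1) ^ r * (Polynomial.C r * (2 * M + 2) + 2), fun I d hd => ?_⟩
  obtain ⟨L, -, hL, hLI, rfl⟩ := encodedBy_iff.1 hd
  obtain ⟨m, hm, hle⟩ := hp (I.n, I.k, L.map (List.map Fin.val))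
  obtain ⟨J, hJ, hyes, hn, hk, hsub⟩ := exists_kernel_instance htr I hL hLI
  refine ⟨J, _, m, hm, hle, hJ, hyes, hn, hk.le, hJ.size_le.trans ?_, hsub⟩
  have hM : M.eval I.k = 2 * (r ^ r * I.k ^ (r - t - 1)) := by
    simp [M, mul_assoc]
  rw [← hM] at hn
  simp only [Polynomial.eval_add, Polynomial.eval_mul, Polynomial.eval_pow, Polynomial.eval_C,
    Polynomial.eval_X, Polynomial.eval_one, Polynomial.eval_ofNat, hk]
  gcongr
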